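/- Let $1<p\le q<\infty$, $p^*=p/(p-1)$, and let $$k_{q,p}=\left(\frac{r}{B(1/r,(q-1)/r)}\right)^{1/p-1/q}\quad\text{with } r=\frac qp-1,\ B(a,b)=\int_0^1x^{a-1}(1-x)^{b-1}\,dx,\qquad\text{if } p<q,$$ and $k_{p,p}=p^{1/p}(p^*)^{1/p^*}$ if $p=q$. Let $\nu$ be a Borel measure on $\mathbb R$, put $S(x)=\nu((-\infty,x])\in[0,\infty]$ for $x\in\mathbb R$, and suppose that $S(+\infty):=\lim_{x\to+\infty}S(x)=+\infty$. Use the conventions $0^{-q/p^*}=\infty$ and $\infty^{-q/p^*}=0$. (a) If $S(x)<\infty$ for all $x\in\mathbb R$, then there is a Borel measure $\widetilde\nu$ on $\mathbb R$ such that $$\widetilde\nu((x,+\infty))=S(x)^{-q/p^*}\quad\text{for all }x\in\mathbb R.\qquad(*)$$ (b) For every Borel measure $\widetilde\nu$ on $\mathbb R$ satisfying $(*)$ and every Borel measurable function $f:\mathbb R\to[0,\infty)$, $$\left[\int_{\mathbb R}\left(\int_{(-\infty,x)}f(y)\,\nu(dy)\right)^q\widetilde\nu(dx)\right]^{1/q}\le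 k_{q,p}\left[\int_{\mathbb R}f(y)^p\,\nu(dy)\right]^{1/p},$$ where both sides may be $+\infty$. -/

import Mathlib

open MeasureTheory Filter Topology Set
open scoped ENNReal

noncomputable section

/-- Euler's beta integral `B(a, b) = ∫₀¹ x ^ (a - 1) * (1 - x) ^ (b - 1) dx`
(convergent for `a, b > 0`). -/
def eulerBeta (a b : ℝ) : ℝ :=
  ∫ x in (0 : ℝ)..1, x ^ (a - 1) * (1 - x) ^ (b - 1)

/-- The sharp factor `k_{q,p}`, where `r = q / p - 1` and `p* = p / (p - 1)`. For `p < q` it is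
`(r / B(1 / r, (q - 1) / r)) ^ (1 / p - 1 / q)`. That formula has no meaning at `p = q`
(`r = 0`), where the factor is `p ^ (1 / p) * (p*) ^ (1 / p*)`. -/
def sharpFactor (q p : ℝ) : ℝ :=
  if p = q then
    p ^ (1 / p) * p.conjExponent ^ (1 / p.conjExponent)
  else
    ((q / p - 1) / eulerBeta (1 / (q / p - 1)) ((q - 1) / (q / p - 1))) ^ (1 / p - 1 / q)

/-- The cumulative distribution function `S(x) = ν((-∞, x])` of a Borel measure, with values
in `[0, ∞]`. -/
def cumul (ν : Measure ℝ) (x : ℝ) : ℝ≥0∞ :=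
  ν (Iic x)

/-- `ν'` is a Borel measure with `ν'((x, ∞)) = S(x) ^ (-q / p*)` for every real `x`,
with the conventions `0 ^ (-q / p*) = ∞` and `∞ ^ (-q / p*) = 0`. -/
def HasBlissTail (q p : ℝ) (ν ν' : Measure ℝ) : Prop :=
  ∀ x : ℝ, ν' (Ioi x) = cumul ν x ^ (-(q / p.conjExponent))

end

/-!
Let `T` be the quantile function of `ν`. It pushes Lebesgue measure on `(0, ∞)` forward to `ν`,
where `S` is finite, and the measure on `(0, ∞)` with tail `a ↦ a ^ (-q / p*)` to a measure
satisfying `(*)`. This proves (a), and reduces (b) to the two measures on `(0, ∞)`, where it is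
Bliss's inequality, or Hardy's if `p = q`. By approximation in `L ^ p` and Fatou's lemma it
suffices to treat bounded, continuous, positive, integrable `f` there.

Write `F x = ∫₀ˣ f` and `α = q / p*`, and let `w` be a decreasing weight. Integrating by parts and
then applying Hölder's inequality, `∫ F ^ (α + 1) * (-w') ≤ (α + 1) * ‖f‖_p * ‖F ^ α * w‖_{p*}`.
For `p = q` the weight `x ^ (-(p - 1))` gives Hardy's inequality. For `p < q` let `θ` be the
monotone transport of `F ^ q * x ^ (-(α + 1)) dx` to a multiple of the beta prime law with
parameters `1 / r + 1` and `α / r`, and take `w = (x ^ (α + 1) * θ) ^ (-1 / p*)`. The right-hand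
integral is then that of `1 / θ` and, after an AM-GM step, the left-hand one that of
`(1 + θ) / θ`, both against the transported density. So the two are explicit beta integrals that
do not depend on `f`.
-/

lemma ofReal_betaIntegrand {a b x : ℝ} (hx : x ∈ Icc (0 : ℝ) 1) :
    (x : ℂ) ^ ((a : ℂ) - 1) * (1 - (x : ℂ)) ^ ((b : ℂ) - 1) =
      ((x ^ (a - 1) * (1 - x) ^ (b - 1) : ℝ) : ℂ) := by
  have h1 : 0 ≤ 1 - x := by linarith [hx.2]
  rw [Complex.ofReal_mul, Complex.ofReal_cpow hx.1, Complex.ofReal_cpow h1]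
  push_cast
  rfl

lemma intervalIntegrable_betaIntegrand {a b : ℝ} (ha : 0 < a) (hb : 0 < b) :
    IntervalIntegrable (fun x : ℝ => x ^ (a - 1) * (1 - x) ^ (b - 1)) volume 0 1 := by
  have h := Complex.betaIntegral_convergent (u := a) (v := b) (by simpa) (by simpa)
  rw [intervalIntegrable_iff_integrableOn_Ioc_of_le zero_le_one] at h ⊢
  refine IntegrableOn.congr_fun (f := fun x : ℝ =>
    ((x : ℂ) ^ ((a : ℂ) - 1) * (1 - (x : ℂ)) ^ ((b : ℂ) - 1)).re) h.re ?_ measurableSet_Ioc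
  intro x hx
  simp only
  rw [ofReal_betaIntegrand ⟨hx.1.le, hx.2⟩, Complex.ofReal_re]

lemma eulerBeta_eq_beta {a b : ℝ} (ha : 0 < a) (hb : 0 < b) :
    eulerBeta a b = ProbabilityTheory.beta a b := by
  rw [ProbabilityTheory.beta_eq_betaIntegralReal a b ha hb, eulerBeta, Complex.betaIntegral]
  rw [intervalIntegral.integral_congr (g := fun x : ℝ =>
    ((x ^ (a - 1) * (1 - x) ^ (b - 1) : ℝ) : ℂ)), intervalIntegral.integral_ofReal,
    Complex.ofReal_re]
  intro x hx
  rw [uIcc_of_le zero_le_one] at hx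
  exact ofReal_betaIntegrand hx

lemma eulerBeta_pos {a b : ℝ} (ha : 0 < a) (hb : 0 < b) : 0 < eulerBeta a b := by
  rw [eulerBeta_eq_beta ha hb]
  exact ProbabilityTheory.beta_pos ha hb

lemma eulerBeta_add_one_right {a b : ℝ} (ha : 0 < a) (hb : 0 < b) :
    eulerBeta a (b + 1) = b / (a + b) * eulerBeta a b := by
  rw [eulerBeta_eq_beta ha (by linarith), eulerBeta_eq_beta ha hb, ProbabilityTheory.beta,
    ProbabilityTheory.beta, ← add_assoc, Real.Gamma_add_one hb.ne',
    Real.Gamma_add_one (add_pos ha hb).ne']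
  have := (Real.Gamma_pos_of_pos (add_pos ha hb)).ne'
  have := (add_pos ha hb).ne'
  field_simp

lemma eulerBeta_add_one_left {a b : ℝ} (ha : 0 < a) (hb : 0 < b) :
    eulerBeta (a + 1) b = a / (a + b) * eulerBeta a b := by
  rw [eulerBeta_eq_beta (by linarith) hb, eulerBeta_eq_beta ha hb, ProbabilityTheory.beta,
    ProbabilityTheory.beta, add_right_comm, Real.Gamma_add_one ha.ne',
    Real.Gamma_add_one (add_pos ha hb).ne']
  have := (Real.Gamma_pos_of_pos (add_pos ha hb)).ne'
  have := (add_pos ha hb).ne'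
  field_simp

lemma lintegral_betaIntegrand {a b : ℝ} (ha : 0 < a) (hb : 0 < b) :
    ∫⁻ x in Ioo (0 : ℝ) 1, ENNReal.ofReal (x ^ (a - 1) * (1 - x) ^ (b - 1)) =
      ENNReal.ofReal (eulerBeta a b) := by
  have h := intervalIntegrable_betaIntegrand ha hb
  rw [intervalIntegrable_iff_integrableOn_Ioc_of_le zero_le_one] at h
  rw [eulerBeta, intervalIntegral.integral_of_le zero_le_one,
    ofReal_integral_eq_lintegral_ofReal h, restrict_Ioo_eq_restrict_Ioc]
  filter_upwards [ae_restrict_mem measurableSet_Ioc] with x hx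
  have h1 : 0 ≤ 1 - x := by linarith [hx.2]
  have h0 : 0 ≤ x := hx.1.le
  simp only [Pi.zero_apply]
  positivity

/-- The unnormalised density of the beta prime distribution, the law of `t / (1 - t)` when `t` is
beta distributed. -/
noncomputable def betaPrimeDensity (a b y : ℝ) : ℝ :=
  y ^ (a - 1) * (1 + y) ^ (-(a + b))

lemma lintegral_betaPrimeDensity {a b : ℝ} (ha : 0 < a) (hb : 0 < b) :
    ∫⁻ y in Ioi (0 : ℝ), ENNReal.ofReal (betaPrimeDensity a b y) =
      ENNReal.ofReal (eulerBeta a b) := by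
  have hderiv : ∀ y ∈ Ioi (0 : ℝ),
      HasDerivWithinAt (fun y => y / (1 + y)) (1 / (1 + y) ^ 2) (Ioi 0) y := by
    intro y (hy : 0 < y)
    have h := (hasDerivAt_id' y).fun_div ((hasDerivAt_id' y).const_add 1) (by positivity)
    exact (h.congr_deriv (by ring)).hasDerivWithinAt
  have hinj : InjOn (fun y : ℝ => y / (1 + y)) (Ioi 0) := by
    intro y (hy : 0 < y) z (hz : 0 < z) h
    rw [div_eq_div_iff (by positivity) (by positivity)] at h
    linarith
  have himage : (fun y : ℝ => y / (1 + y)) '' Ioi 0 = Ioo 0 1 := by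
    refine Subset.antisymm ?_ fun t ht => ⟨t / (1 - t), ?_, ?_⟩
    · rintro _ ⟨y, hy : 0 < y, rfl⟩
      exact ⟨by positivity, (div_lt_one (by positivity)).2 (by linarith)⟩
    · exact div_pos ht.1 (sub_pos.2 ht.2)
    · have := (sub_pos.2 ht.2).ne'
      field_simp
      ring
  rw [← lintegral_betaIntegrand ha hb, ← himage,
    lintegral_image_eq_lintegral_abs_deriv_mul measurableSet_Ioi hderiv hinj]
  refine setLIntegral_congr_fun measurableSet_Ioi fun y (hy : 0 < y) => ?_
  have h1 : 0 < 1 + y := by positivity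
  have hsub : 1 - y / (1 + y) = (1 + y)⁻¹ := by field_simp; ring
  rw [betaPrimeDensity, ← ENNReal.ofReal_mul (abs_nonneg _), abs_of_pos (by positivity), hsub,
    Real.div_rpow hy.le h1.le, Real.inv_rpow h1.le, show -(a + b) = -2 - (a - 1) - (b - 1) by ring,
    Real.rpow_sub h1, Real.rpow_sub h1, Real.rpow_neg h1.le, Real.rpow_two]
  congr 1
  field_simp

/-! ### Positive densities on the half-line and their monotone transport -/

lemma image_eq_Ioo_of_strictMonoOn_of_tendsto {α β : Type*} [TopologicalSpace α] [Preorder α]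
    [LinearOrder β] [TopologicalSpace β] [OrderClosedTopology β] {s : Set α}
    (hs : IsPreconnected s) {l₁ l₂ : Filter α} [l₁.NeBot] [l₂.NeBot] (hl₁ : l₁ ≤ 𝓟 s)
    (hl₂ : l₂ ≤ 𝓟 s) (h₁ : ∀ x ∈ s, ∀ᶠ y in l₁, y < x) (h₂ : ∀ x ∈ s, ∀ᶠ y in l₂, x < y)
    {g : α → β} {u v : β} (hg : StrictMonoOn g s) (hgc : ContinuousOn g s)
    (hu : Tendsto g l₁ (𝓝 u)) (hv : Tendsto g l₂ (𝓝 v)) : g '' s = Ioo u v := by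
  refine Subset.antisymm ?_ (hs.intermediate_value_Ioo hl₁ hl₂ hgc hu hv)
  have hlower : ∀ x ∈ s, u ≤ g x := fun x hx => le_of_tendsto hu <| by
    filter_upwards [h₁ x hx, hl₁ (mem_principal_self s)] with y hy hys using (hg hys hx hy).le
  have hupper : ∀ x ∈ s, g x ≤ v := fun x hx => ge_of_tendsto hv <| by
    filter_upwards [h₂ x hx, hl₂ (mem_principal_self s)] with y hy hys using (hg hx hys hy).le
  rintro _ ⟨x, hx, rfl⟩
  obtain ⟨y, hyx, hy⟩ := ((h₁ x hx).and (hl₁ (mem_principal_self s))).exists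
  obtain ⟨z, hxz, hz⟩ := ((h₂ x hx).and (hl₂ (mem_principal_self s))).exists
  exact ⟨(hlower y hy).trans_lt (hg hy hx hyx), (hg hx hz hxz).trans_le (hupper z hz)⟩

/-- The primitive of `g` vanishing at `0`. -/
noncomputable def primitive (g : ℝ → ℝ) (x : ℝ) : ℝ :=
  ∫ t in (0 : ℝ)..x, g t

/-- `g` restricts to a continuous, positive and integrable density on `(0, ∞)`; its values on
`(-∞, 0]` are irrelevant. -/
structure IsPositiveDensity (g : ℝ → ℝ) : Prop where
  continuousOn : ContinuousOn g (Ioi 0)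
  pos : ∀ x > 0, 0 < g x
  integrableOn : IntegrableOn g (Ioi 0)

namespace IsPositiveDensity

variable {g h : ℝ → ℝ} {x y : ℝ}

lemma intervalIntegrable (hg : IsPositiveDensity g) (hx : 0 ≤ x) (hy : 0 ≤ y) :
    IntervalIntegrable g volume x y :=
  ⟨hg.integrableOn.mono_set (Ioc_subset_Ioi_self.trans (Ioi_subset_Ioi hx)),
    hg.integrableOn.mono_set (Ioc_subset_Ioi_self.trans (Ioi_subset_Ioi hy))⟩

lemma hasDerivAt_primitive (hg : IsPositiveDensity g) (hx : 0 < x) :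
    HasDerivAt (primitive g) (g x) x :=
  intervalIntegral.integral_hasDerivAt_right (hg.intervalIntegrable le_rfl hx.le)
    (hg.continuousOn.stronglyMeasurableAtFilter isOpen_Ioi x hx)
    (hg.continuousOn.continuousAt (Ioi_mem_nhds hx))

lemma continuousOn_primitive (hg : IsPositiveDensity g) : ContinuousOn (primitive g) (Ioi 0) :=
  fun _ hx => (hg.hasDerivAt_primitive hx).continuousAt.continuousWithinAt

lemma strictMonoOn_primitive (hg : IsPositiveDensity g) : StrictMonoOn (primitive g) (Ioi 0) := by
  refine strictMonoOn_of_hasDerivWithinAt_pos (convex_Ioi 0) hg.continuousOn_primitive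
    (f' := g) (fun x hx => ?_) fun x hx => ?_ <;> rw [interior_Ioi] at hx
  · exact (hg.hasDerivAt_primitive hx).hasDerivWithinAt
  · exact hg.pos x hx

lemma tendsto_primitive_zero (hg : IsPositiveDensity g) :
    Tendsto (primitive g) (𝓝[>] 0) (𝓝 0) := by
  have hcont : ContinuousOn (primitive g) (Icc 0 1) :=
    intervalIntegral.continuousOn_primitive_interval' (hg.intervalIntegrable le_rfl zero_le_one)
      left_mem_uIcc |>.mono (by rw [uIcc_of_le zero_le_one])
  have h0 := hcont 0 (left_mem_Icc.2 zero_le_one)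
  rw [ContinuousWithinAt, primitive, intervalIntegral.integral_same] at h0
  exact h0.mono_left (nhdsWithin_le_of_mem (Icc_mem_nhdsGT zero_lt_one))

lemma tendsto_primitive_atTop (hg : IsPositiveDensity g) :
    Tendsto (primitive g) atTop (𝓝 (∫ t in Ioi 0, g t)) :=
  intervalIntegral_tendsto_integral_Ioi 0 hg.integrableOn tendsto_id

lemma image_primitive (hg : IsPositiveDensity g) :
    primitive g '' Ioi 0 = Ioo 0 (∫ t in Ioi 0, g t) :=
  image_eq_Ioo_of_strictMonoOn_of_tendsto isPreconnected_Ioi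
    (l₁ := 𝓝[>] 0) (l₂ := atTop) inf_le_right
    (le_principal_iff.2 (Ioi_mem_atTop 0)) (fun _ hx => nhdsWithin_le_nhds (Iio_mem_nhds hx))
    (fun x _ => eventually_gt_atTop x) hg.strictMonoOn_primitive hg.continuousOn_primitive
    hg.tendsto_primitive_zero hg.tendsto_primitive_atTop

lemma primitive_mem_Ioo (hg : IsPositiveDensity g) (hx : 0 < x) :
    primitive g x ∈ Ioo 0 (∫ t in Ioi 0, g t) :=
  hg.image_primitive ▸ mem_image_of_mem _ hx

lemma primitive_pos (hg : IsPositiveDensity g) (hx : 0 < x) : 0 < primitive g x :=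
  (hg.primitive_mem_Ioo hx).1

lemma integral_pos (hg : IsPositiveDensity g) : 0 < ∫ t in Ioi 0, g t :=
  (hg.primitive_pos one_pos).trans (hg.primitive_mem_Ioo one_pos).2

lemma lintegral_eq (hg : IsPositiveDensity g) :
    ∫⁻ t in Ioi 0, ENNReal.ofReal (g t) = ENNReal.ofReal (∫ t in Ioi 0, g t) :=
  (ofReal_integral_eq_lintegral_ofReal hg.integrableOn
    ((ae_restrict_mem measurableSet_Ioi).mono fun t ht => (hg.pos t ht).le)).symm

lemma of_lintegral_eq {c : ℝ} (hcont : ContinuousOn g (Ioi 0)) (hpos : ∀ x > 0, 0 < g x)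
    (hc : ∫⁻ t in Ioi 0, ENNReal.ofReal (g t) = ENNReal.ofReal c) : IsPositiveDensity g where
  continuousOn := hcont
  pos := hpos
  integrableOn := by
    refine (lintegral_ofReal_ne_top_iff_integrable
      (hcont.aestronglyMeasurable measurableSet_Ioi) ?_).1 (hc ▸ ENNReal.ofReal_ne_top)
    exact (ae_restrict_mem measurableSet_Ioi).mono fun t ht => (hpos t ht).le

end IsPositiveDensity

/-- `θ` is the increasing rearrangement of `(0, ∞)` that transports the density `g` to the
density `h`; the defining property `h (θ x) * θ' x = g x` is stated as a formula for `θ'`. -/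
structure IsTransport (g h θ : ℝ → ℝ) : Prop where
  strictMonoOn : StrictMonoOn θ (Ioi 0)
  image_eq : θ '' Ioi 0 = Ioi 0
  hasDerivAt : ∀ x > 0, HasDerivAt θ (g x / h (θ x)) x

lemma IsTransport.pos {g h θ : ℝ → ℝ} (hθ : IsTransport g h θ) {x : ℝ} (hx : 0 < x) : 0 < θ x :=
  hθ.image_eq.subset (mem_image_of_mem θ hx)

lemma IsTransport.continuousOn {g h θ : ℝ → ℝ} (hθ : IsTransport g h θ) :
    ContinuousOn θ (Ioi 0) :=
  fun x hx => (hθ.hasDerivAt x hx).continuousAt.continuousWithinAt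

lemma IsTransport.lintegral_comp {g h θ : ℝ → ℝ} (hθ : IsTransport g h θ)
    (hg : ∀ x > 0, 0 ≤ g x) (hh : ∀ x > 0, 0 < h x) (φ : ℝ → ℝ≥0∞) :
    ∫⁻ x in Ioi 0, ENNReal.ofReal (g x) * φ (θ x) =
      ∫⁻ y in Ioi 0, ENNReal.ofReal (h y) * φ y := by
  conv_rhs => rw [← hθ.image_eq]
  rw [lintegral_image_eq_lintegral_abs_deriv_mul measurableSet_Ioi
    (fun x hx => (hθ.hasDerivAt x hx).hasDerivWithinAt) hθ.strictMonoOn.injOn]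
  refine setLIntegral_congr_fun measurableSet_Ioi fun x hx => ?_
  have hhx := hh _ (hθ.pos hx)
  rw [← mul_assoc, ← ENNReal.ofReal_mul (abs_nonneg _),
    abs_of_nonneg (div_nonneg (hg x hx) hhx.le), div_mul_cancel₀ _ hhx.ne']

lemma exists_isTransport {g h : ℝ → ℝ} (hg : IsPositiveDensity g) (hh : IsPositiveDensity h)
    (hgh : ∫ t in Ioi 0, g t = ∫ t in Ioi 0, h t) : ∃ θ, IsTransport g h θ := by
  set θ : ℝ → ℝ := fun x => Function.invFunOn (primitive h) (Ioi 0) (primitive g x)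
  have himage : primitive g '' Ioi 0 = primitive h '' Ioi 0 := by
    rw [hg.image_primitive, hh.image_primitive, hgh]
  have hex : ∀ x > 0, primitive g x ∈ primitive h '' Ioi 0 := fun x hx =>
    himage ▸ mem_image_of_mem _ hx
  have hθpos : ∀ x > 0, 0 < θ x := fun x hx => Function.invFunOn_mem (hex x hx)
  have hθ : ∀ x > 0, primitive h (θ x) = primitive g x := fun x hx =>
    Function.invFunOn_eq (hex x hx)
  have hmono : StrictMonoOn θ (Ioi 0) := fun x hx y hy hxy =>
    (hh.strictMonoOn_primitive.lt_iff_lt (hθpos x hx) (hθpos y hy)).1 <| by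
      rw [hθ x hx, hθ y hy]
      exact hg.strictMonoOn_primitive hx hy hxy
  have himageθ : θ '' Ioi 0 = Ioi 0 := by
    refine Subset.antisymm (image_subset_iff.2 hθpos) fun y hy => ?_
    obtain ⟨x, hx, hxy⟩ := himage.symm.subset (mem_image_of_mem (primitive h) hy)
    exact ⟨x, hx, hh.strictMonoOn_primitive.injOn (hθpos x hx) hy ((hθ x hx).trans hxy)⟩
  refine ⟨θ, hmono, himageθ, fun x hx => ?_⟩
  have hcont : ContinuousAt θ x := hmono.continuousAt_of_image_mem_nhds (Ioi_mem_nhds hx)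
    (by rw [himageθ]; exact Ioi_mem_nhds (hθpos x hx))
  exact .of_comp_left hcont (hh.hasDerivAt_primitive (hθpos x hx)) (hg.hasDerivAt_primitive hx)
    (hh.pos _ (hθpos x hx)).ne' (eventually_of_mem (Ioi_mem_nhds hx) hθ)

section IntegrationByParts

variable {P A D : ℝ → ℝ}

lemma lintegral_Ioc_le_of_hasDerivAt_sub {u v : ℝ} (huv : u ≤ v)
    (hP : ∀ x ∈ Icc u v, HasDerivAt P (A x - D x) x) (hA : ContinuousOn A (Icc u v))
    (hD : ContinuousOn D (Icc u v)) (hA0 : ∀ x ∈ Icc u v, 0 ≤ A x)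
    (hD0 : ∀ x ∈ Icc u v, 0 ≤ D x) (hPu : 0 ≤ P u) (hPv : 0 ≤ P v) :
    ∫⁻ x in Ioc u v, ENNReal.ofReal (D x) ≤
      (∫⁻ x in Ioc u v, ENNReal.ofReal (A x)) + ENNReal.ofReal (P u) := by
  have hAi := hA.intervalIntegrable_of_Icc (μ := volume) huv
  have hDi := hD.intervalIntegrable_of_Icc (μ := volume) huv
  have hftc := intervalIntegral.integral_eq_sub_of_hasDerivAt
    (fun x hx => hP x (uIcc_of_le huv ▸ hx)) (hAi.sub hDi)
  rw [intervalIntegral.integral_sub hAi hDi, intervalIntegral.integral_of_le huv,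
    intervalIntegral.integral_of_le huv] at hftc
  rw [intervalIntegrable_iff_integrableOn_Ioc_of_le huv] at hAi hDi
  have hAn : 0 ≤ᵐ[volume.restrict (Ioc u v)] A :=
    (ae_restrict_mem measurableSet_Ioc).mono fun x hx => hA0 x (Ioc_subset_Icc_self hx)
  have hDn : 0 ≤ᵐ[volume.restrict (Ioc u v)] D :=
    (ae_restrict_mem measurableSet_Ioc).mono fun x hx => hD0 x (Ioc_subset_Icc_self hx)
  rw [← ofReal_integral_eq_lintegral_ofReal hAi hAn, ← ofReal_integral_eq_lintegral_ofReal hDi hDn,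
    ← ENNReal.ofReal_add (integral_nonneg_of_ae hAn) hPu]
  exact ENNReal.ofReal_le_ofReal (by linarith)

lemma lintegral_Ioi_le_of_hasDerivAt_sub (hP : ∀ x > 0, HasDerivAt P (A x - D x) x)
    (hA : ContinuousOn A (Ioi 0)) (hD : ContinuousOn D (Ioi 0)) (hA0 : ∀ x > 0, 0 ≤ A x)
    (hD0 : ∀ x > 0, 0 ≤ D x) (hP0 : ∀ x > 0, 0 ≤ P x)
    (hlim : ∀ ε > 0, ∃ᶠ u in 𝓝[>] 0, P u < ε) :
    ∫⁻ x in Ioi 0, ENNReal.ofReal (D x) ≤ ∫⁻ x in Ioi 0, ENNReal.ofReal (A x) := by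
  have hIoc : ∀ u v : ℝ, 0 < u →
      ∫⁻ x in Ioc u v, ENNReal.ofReal (D x) ≤ ∫⁻ x in Ioi 0, ENNReal.ofReal (A x) := by
    intro u v hu
    refine ENNReal.le_of_forall_pos_le_add fun ε hε _ => ?_
    obtain ⟨w, hPw, hw⟩ := ((hlim ε hε).and_eventually (Ioo_mem_nhdsGT hu)).exists
    rcases lt_or_ge v w with hvw | hwv
    · simp [Ioc_eq_empty (hvw.trans hw.2).not_gt]
    have hpos : ∀ x ∈ Icc w v, 0 < x := fun x hx => hw.1.trans_le hx.1
    calc ∫⁻ x in Ioc u v, ENNReal.ofReal (D x)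
        ≤ ∫⁻ x in Ioc w v, ENNReal.ofReal (D x) :=
          lintegral_mono_set (Ioc_subset_Ioc_left hw.2.le)
      _ ≤ (∫⁻ x in Ioc w v, ENNReal.ofReal (A x)) + ENNReal.ofReal (P w) :=
          lintegral_Ioc_le_of_hasDerivAt_sub hwv (fun x hx => hP x (hpos x hx)) (hA.mono hpos)
            (hD.mono hpos) (fun x hx => hA0 x (hpos x hx)) (fun x hx => hD0 x (hpos x hx))
            (hP0 w hw.1) (hP0 v (hw.1.trans_le hwv))
      _ ≤ (∫⁻ x in Ioi 0, ENNReal.ofReal (A x)) + ε := by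
          gcongr
          · exact Ioc_subset_Ioi_self.trans (Ioi_subset_Ioi hw.1.le)
          · exact ENNReal.ofReal_le_of_le_toReal hPw.le
  have hcover := (aecover_Ioi_of_Ioi (μ := volume) (A := (0 : ℝ))
    tendsto_one_div_add_atTop_nhds_zero_nat).inter (aecover_Iic tendsto_natCast_atTop_atTop)
  refine le_of_tendsto' (hcover.lintegral_tendsto_of_countably_generated
    (hD.aemeasurable measurableSet_Ioi).ennreal_ofReal) fun n => ?_
  exact (lintegral_mono' (Measure.restrict_mono subset_rfl Measure.restrict_le_self) le_rfl).trans
    (hIoc _ _ Nat.one_div_pos_of_nat)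

end IntegrationByParts

/-- Otherwise `g` would dominate a multiple of the nonintegrable function `x⁻¹` near `0`. -/
lemma frequently_mul_lt_of_lintegral_rpow_ne_top {g : ℝ → ℝ} {s : ℝ} (hs : 1 ≤ s)
    (hg : ∫⁻ x in Ioi 0, ENNReal.ofReal (g x) ^ s ≠ ∞) {ε : ℝ} (hε : 0 < ε) :
    ∃ᶠ x in 𝓝[>] (0 : ℝ), x * g x < ε := by
  intro hfar
  obtain ⟨δ, hδ : 0 < δ, hfar⟩ := (mem_nhdsGT_iff_exists_Ioo_subset).1 hfar
  have hle : ∀ x ∈ Ioo 0 δ, ENNReal.ofReal (ε ^ s * x ^ (-s)) ≤ ENNReal.ofReal (g x) ^ s := by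
    intro x hx
    have hgx : ε / x ≤ g x := (div_le_iff₀' hx.1).2 (not_lt.1 (hfar hx))
    rw [Real.rpow_neg hx.1.le, ← div_eq_mul_inv, ← Real.div_rpow hε.le hx.1.le,
      ← ENNReal.ofReal_rpow_of_pos (div_pos hε hx.1)]
    gcongr
  have hfin : ∫⁻ x in Ioo 0 δ, ENNReal.ofReal (ε ^ s * x ^ (-s)) ≠ ∞ :=
    ((setLIntegral_mono' measurableSet_Ioo hle).trans
      (lintegral_mono_set Ioo_subset_Ioi_self)).trans_lt hg.lt_top |>.ne
  have hint : IntegrableOn (fun x => ε ^ s * x ^ (-s)) (Ioo 0 δ) := by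
    refine (lintegral_ofReal_ne_top_iff_integrable (by fun_prop) ?_).1 hfin
    filter_upwards [ae_restrict_mem measurableSet_Ioo] with x hx
    have := hx.1.le
    positivity
  rw [IntegrableOn, integrable_const_mul_iff (Real.rpow_pos_of_pos hε s).ne'.isUnit,
    ← IntegrableOn, intervalIntegral.integrableOn_Ioo_rpow_iff hδ] at hint
  linarith

namespace IsPositiveDensity

variable {f : ℝ → ℝ} {L : ℝ}

lemma primitive_le_mul (hf : IsPositiveDensity f) (hL : ∀ x > 0, f x ≤ L) {x : ℝ} (hx : 0 < x) :
    primitive f x ≤ L * x := by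
  have h := intervalIntegral.integral_mono_on_of_le_Ioo hx.le
    (hf.intervalIntegrable le_rfl hx.le) intervalIntegrable_const fun t ht => hL t ht.1
  simpa [primitive, mul_comm] using h

lemma continuousOn_primitive_rpow (hf : IsPositiveDensity f) (s : ℝ) :
    ContinuousOn (fun x => primitive f x ^ s) (Ioi 0) :=
  hf.continuousOn_primitive.rpow_const fun _ hx => Or.inl (hf.primitive_pos hx).ne'

lemma continuousOn_primitive_rpow_mul_rpow (hf : IsPositiveDensity f) (s t : ℝ) :
    ContinuousOn (fun x => primitive f x ^ s * x ^ t) (Ioi 0) :=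
  (hf.continuousOn_primitive_rpow s).mul
    (continuousOn_id.rpow_const fun _ hx => Or.inl (ne_of_gt hx))

lemma lintegral_rpow_ne_zero (hf : IsPositiveDensity f) (p : ℝ) :
    ∫⁻ x in Ioi 0, ENNReal.ofReal (f x) ^ p ≠ 0 := by
  have : NeZero (volume.restrict (Ioi (0 : ℝ))) := ⟨by simp [Measure.restrict_eq_zero]⟩
  intro h0
  rw [lintegral_eq_zero_iff'
    ((hf.continuousOn.aemeasurable measurableSet_Ioi).ennreal_ofReal.pow_const p)] at h0
  obtain ⟨x, hx0, hx⟩ := (h0.and (ae_restrict_mem measurableSet_Ioi)).exists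
  exact (ENNReal.rpow_pos (ENNReal.ofReal_pos.2 (hf.pos x hx)) ENNReal.ofReal_ne_top).ne' hx0

lemma frequently_primitive_rpow_mul_lt (hf : IsPositiveDensity f) (hL : ∀ x > 0, f x ≤ L)
    {s α : ℝ} (hs : 1 ≤ s) {w : ℝ → ℝ} (hw : ∀ x > 0, 0 ≤ w x)
    (hfin : ∫⁻ x in Ioi 0, ENNReal.ofReal (primitive f x ^ α * w x) ^ s ≠ ∞) {ε : ℝ}
    (hε : 0 < ε) : ∃ᶠ x in 𝓝[>] 0, primitive f x ^ (α + 1) * w x < ε := by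
  have hL0 : 0 < L := (hf.pos 1 one_pos).trans_le (hL 1 one_pos)
  refine ((frequently_mul_lt_of_lintegral_rpow_ne_top hs hfin
    (div_pos hε hL0)).and_eventually self_mem_nhdsWithin).mono fun x ⟨hxε, hx⟩ => ?_
  have hF := hf.primitive_pos hx
  calc primitive f x ^ (α + 1) * w x = primitive f x * (primitive f x ^ α * w x) := by
        rw [Real.rpow_add_one hF.ne']
        ring
    _ ≤ L * x * (primitive f x ^ α * w x) := by
        gcongr
        exacts [mul_nonneg (by positivity) (hw x hx), hf.primitive_le_mul hL hx]
    _ < ε := by rwa [mul_assoc, ← lt_div_iff₀' hL0]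

lemma lintegral_primitive_rpow_mul_le (hf : IsPositiveDensity f) (hL : ∀ x > 0, f x ≤ L)
    {p p' α : ℝ} (hp : p.HolderConjugate p') (hα : 0 < α) {w v : ℝ → ℝ}
    (hw : ∀ x > 0, 0 ≤ w x) (hwv : ∀ x > 0, HasDerivAt w (-v x) x) (hv : ∀ x > 0, 0 ≤ v x)
    (hvc : ContinuousOn v (Ioi 0)) :
    ∫⁻ x in Ioi 0, ENNReal.ofReal (primitive f x ^ (α + 1) * v x) ≤
      ENNReal.ofReal (α + 1) * ((∫⁻ x in Ioi 0, ENNReal.ofReal (f x) ^ p) ^ (1 / p) *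
        (∫⁻ x in Ioi 0, ENNReal.ofReal (primitive f x ^ α * w x) ^ p') ^ (1 / p')) := by
  rcases eq_or_ne (∫⁻ x in Ioi 0, ENNReal.ofReal (primitive f x ^ α * w x) ^ p') ∞ with htop | hfin
  · rw [htop, ENNReal.top_rpow_of_pos (by simpa using hp.symm.pos), ENNReal.mul_top,
      ENNReal.mul_top]
    · exact le_top
    · simpa using by linarith
    · exact (ENNReal.rpow_eq_zero_iff_of_pos (by simpa using hp.pos)).not.2
        (hf.lintegral_rpow_ne_zero p)
  have hwc : ContinuousOn w (Ioi 0) := fun x hx => (hwv x hx).continuousAt.continuousWithinAt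
  have hFw : ContinuousOn (fun x => primitive f x ^ α * w x) (Ioi 0) :=
    (hf.continuousOn_primitive_rpow α).mul hwc
  have hFw0 : ∀ x > 0, 0 ≤ primitive f x ^ α * w x := fun x hx =>
    mul_nonneg (Real.rpow_nonneg (hf.primitive_pos hx).le _) (hw x hx)
  have hderiv : ∀ x > 0, HasDerivAt (fun x => primitive f x ^ (α + 1) * w x)
      ((α + 1) * (f x * (primitive f x ^ α * w x)) - primitive f x ^ (α + 1) * v x) x := by
    intro x hx
    refine (((hf.hasDerivAt_primitive hx).rpow_const (Or.inl (hf.primitive_pos hx).ne')).fun_mul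
      (hwv x hx)).congr_deriv ?_
    rw [add_sub_cancel_right]
    ring
  calc ∫⁻ x in Ioi 0, ENNReal.ofReal (primitive f x ^ (α + 1) * v x)
      ≤ ∫⁻ x in Ioi 0, ENNReal.ofReal ((α + 1) * (f x * (primitive f x ^ α * w x))) :=
        lintegral_Ioi_le_of_hasDerivAt_sub hderiv
          (continuousOn_const.mul (hf.continuousOn.mul hFw))
          ((hf.continuousOn_primitive_rpow _).mul hvc)
          (fun x hx => mul_nonneg (by linarith) (mul_nonneg (hf.pos x hx).le (hFw0 x hx)))
          (fun x hx => mul_nonneg (Real.rpow_nonneg (hf.primitive_pos hx).le _) (hv x hx))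
          (fun x hx => mul_nonneg (Real.rpow_nonneg (hf.primitive_pos hx).le _) (hw x hx))
          fun ε hε => hf.frequently_primitive_rpow_mul_lt hL hp.symm.lt.le hw hfin hε
    _ = ENNReal.ofReal (α + 1) *
        ∫⁻ x in Ioi 0, ENNReal.ofReal (f x) * ENNReal.ofReal (primitive f x ^ α * w x) := by
        rw [← lintegral_const_mul' _ _ ENNReal.ofReal_ne_top]
        refine setLIntegral_congr_fun measurableSet_Ioi fun x hx => ?_
        rw [ENNReal.ofReal_mul (by linarith), ENNReal.ofReal_mul (hf.pos x hx).le]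
    _ ≤ _ := by
        gcongr
        exact ENNReal.lintegral_mul_le_Lp_mul_Lq _ hp
          (hf.continuousOn.aemeasurable measurableSet_Ioi).ennreal_ofReal
          (hFw.aemeasurable measurableSet_Ioi).ennreal_ofReal

lemma primitive_rpow_mul_rpow (hf : IsPositiveDensity f) (hL : ∀ x > 0, f x ≤ L) {q s : ℝ}
    (hq : 0 < q) (hs : 1 < s) (hsq : s < q + 1) :
    IsPositiveDensity fun x => primitive f x ^ q * x ^ (-s) where
  continuousOn := hf.continuousOn_primitive_rpow_mul_rpow q (-s)
  pos x hx := mul_pos (Real.rpow_pos_of_pos (hf.primitive_pos hx) _) (Real.rpow_pos_of_pos hx _)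
  integrableOn := by
    have hmeas {s' : Set ℝ} (hs' : MeasurableSet s') (hsub : s' ⊆ Ioi 0) :
        AEStronglyMeasurable (fun x => primitive f x ^ q * x ^ (-s)) (volume.restrict s') :=
      ((hf.continuousOn_primitive_rpow_mul_rpow q (-s)).mono hsub).aestronglyMeasurable hs'
    rw [← Ioc_union_Ioi_eq_Ioi zero_le_one]
    refine IntegrableOn.union ?_ ?_
    · have hL0 : 0 < L := (hf.pos 1 one_pos).trans_le (hL 1 one_pos)
      have hint : IntegrableOn (fun x : ℝ => L ^ q * x ^ (q - s)) (Ioc 0 1) := by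
        rw [← intervalIntegrable_iff_integrableOn_Ioc_of_le zero_le_one]
        exact (intervalIntegral.intervalIntegrable_rpow' (by linarith)).const_mul _
      refine Integrable.mono' hint (hmeas measurableSet_Ioc Ioc_subset_Ioi_self) ?_
      filter_upwards [ae_restrict_mem measurableSet_Ioc] with x hx
      have hF := hf.primitive_pos hx.1
      rw [Real.norm_of_nonneg (by have := hx.1; positivity), sub_eq_add_neg, Real.rpow_add hx.1,
        ← mul_assoc, ← Real.mul_rpow hL0.le hx.1.le]
      have := hx.1.le
      gcongr
      exact hf.primitive_le_mul hL hx.1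
    · refine Integrable.mono' ((integrableOn_Ioi_rpow_of_lt (by linarith : -s < -1)
        one_pos).const_mul ((∫ x in Ioi 0, f x) ^ q))
        (hmeas measurableSet_Ioi (Ioi_subset_Ioi zero_le_one)) ?_
      filter_upwards [ae_restrict_mem measurableSet_Ioi] with x hx
      have hx0 : 0 < x := one_pos.trans hx
      have hF := hf.primitive_mem_Ioo hx0
      have := hF.1
      rw [Real.norm_of_nonneg (by positivity)]
      gcongr
      exact hF.2.le

end IsPositiveDensity

/-! ### Transport to a beta prime law and Bliss's weight -/

section BetaPrime

variable {a b c : ℝ}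

lemma betaPrimeDensity_add_one_div {y : ℝ} (hy : 0 < y) :
    betaPrimeDensity (a + 1) b y / y = betaPrimeDensity a (b + 1) y := by
  rw [betaPrimeDensity, betaPrimeDensity, add_sub_cancel_right, Real.rpow_sub_one hy.ne',
    add_right_comm, ← add_assoc]
  ring

lemma betaPrimeDensity_add_one_mul {y : ℝ} (hy : 0 < y) :
    betaPrimeDensity (a + 1) b y * ((1 + y) / y) = betaPrimeDensity a b y := by
  have h1 : 0 < 1 + y := by positivity
  rw [betaPrimeDensity, betaPrimeDensity, add_sub_cancel_right, Real.rpow_sub_one hy.ne',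
    show -(a + 1 + b) = -(a + b) - 1 by ring, Real.rpow_sub_one h1.ne']
  field_simp

lemma lintegral_mul_betaPrimeDensity (ha : 0 < a) (hb : 0 < b) (hc : 0 ≤ c) :
    ∫⁻ y in Ioi 0, ENNReal.ofReal (c * betaPrimeDensity a b y) =
      ENNReal.ofReal (c * eulerBeta a b) := by
  simp_rw [ENNReal.ofReal_mul hc]
  rw [lintegral_const_mul' _ _ ENNReal.ofReal_ne_top, lintegral_betaPrimeDensity ha hb]

lemma isPositiveDensity_mul_betaPrimeDensity (ha : 0 < a) (hb : 0 < b) (hc : 0 < c) :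
    IsPositiveDensity fun y => c * betaPrimeDensity a b y := by
  refine .of_lintegral_eq ?_ (fun y hy => ?_) (lintegral_mul_betaPrimeDensity ha hb hc.le)
  · refine continuousOn_const.mul (.mul ?_ ?_)
    · exact continuousOn_id.rpow_const fun y hy => Or.inl (ne_of_gt hy)
    · refine (continuousOn_const.add continuousOn_id).rpow_const fun y (hy : 0 < y) => Or.inl ?_
      exact (add_pos one_pos hy).ne'
  · rw [betaPrimeDensity]
    positivity

lemma integral_mul_betaPrimeDensity (ha : 0 < a) (hb : 0 < b) (hc : 0 < c) :
    ∫ y in Ioi 0, c * betaPrimeDensity a b y = c * eulerBeta a b := by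
  have hdens := isPositiveDensity_mul_betaPrimeDensity ha hb hc
  rw [← ENNReal.ofReal_eq_ofReal_iff hdens.integral_pos.le (mul_pos hc (eulerBeta_pos ha hb)).le,
    ← hdens.lintegral_eq, lintegral_mul_betaPrimeDensity ha hb hc.le]

variable {g θ : ℝ → ℝ}

lemma lintegral_div_transport_betaPrime (ha : 0 < a) (hb : 0 < b) (hc : 0 < c)
    (hg : ∀ x > 0, 0 ≤ g x) (hθ : IsTransport g (fun y => c * betaPrimeDensity (a + 1) b y) θ) :
    ∫⁻ x in Ioi 0, ENNReal.ofReal (g x / θ x) = ENNReal.ofReal (c * eulerBeta a (b + 1)) := by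
  have hh := isPositiveDensity_mul_betaPrimeDensity (add_pos ha one_pos) hb hc
  calc ∫⁻ x in Ioi 0, ENNReal.ofReal (g x / θ x)
      = ∫⁻ x in Ioi 0, ENNReal.ofReal (g x) * ENNReal.ofReal (1 / θ x) :=
        setLIntegral_congr_fun measurableSet_Ioi fun x hx => by
          rw [← ENNReal.ofReal_mul (hg x hx), mul_one_div]
    _ = ∫⁻ y in Ioi 0, ENNReal.ofReal (c * betaPrimeDensity (a + 1) b y) *
          ENNReal.ofReal (1 / y) := hθ.lintegral_comp hg hh.pos fun y => ENNReal.ofReal (1 / y)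
    _ = ∫⁻ y in Ioi 0, ENNReal.ofReal (c * betaPrimeDensity a (b + 1) y) :=
        setLIntegral_congr_fun measurableSet_Ioi fun y hy => by
          rw [← ENNReal.ofReal_mul (hh.pos y hy).le, mul_one_div, mul_div_assoc,
            betaPrimeDensity_add_one_div hy]
    _ = _ := lintegral_mul_betaPrimeDensity ha (by positivity) hc.le

lemma lintegral_mul_transport_betaPrime (ha : 0 < a) (hb : 0 < b) (hc : 0 < c)
    (hg : ∀ x > 0, 0 ≤ g x) (hθ : IsTransport g (fun y => c * betaPrimeDensity (a + 1) b y) θ) :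
    ∫⁻ x in Ioi 0, ENNReal.ofReal (g x * ((1 + θ x) / θ x)) =
      ENNReal.ofReal (c * eulerBeta a b) := by
  have hh := isPositiveDensity_mul_betaPrimeDensity (add_pos ha one_pos) hb hc
  calc ∫⁻ x in Ioi 0, ENNReal.ofReal (g x * ((1 + θ x) / θ x))
      = ∫⁻ x in Ioi 0, ENNReal.ofReal (g x) * ENNReal.ofReal ((1 + θ x) / θ x) :=
        setLIntegral_congr_fun measurableSet_Ioi fun x hx => by
          rw [← ENNReal.ofReal_mul (hg x hx)]
    _ = ∫⁻ y in Ioi 0, ENNReal.ofReal (c * betaPrimeDensity (a + 1) b y) *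
          ENNReal.ofReal ((1 + y) / y) :=
        hθ.lintegral_comp hg hh.pos fun y => ENNReal.ofReal ((1 + y) / y)
    _ = ∫⁻ y in Ioi 0, ENNReal.ofReal (c * betaPrimeDensity a b y) :=
        setLIntegral_congr_fun measurableSet_Ioi fun y hy => by
          rw [← ENNReal.ofReal_mul (hh.pos y hy).le, mul_assoc, betaPrimeDensity_add_one_mul hy]
    _ = _ := lintegral_mul_betaPrimeDensity ha hb hc.le

end BetaPrime

section BlissWeight

variable {p p' q r α : ℝ}

/-- The decreasing weight on `(0, ∞)` whose choice makes both the AM-GM step and the Hölder step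
of the Bliss inequality equalities for the extremal functions. -/
noncomputable def blissWeight (p' α : ℝ) (θ : ℝ → ℝ) (x : ℝ) : ℝ :=
  (x ^ (α + 1) * θ x) ^ (-(1 / p'))

lemma hasDerivAt_blissWeight {θ : ℝ → ℝ} {d x : ℝ} (hx : 0 < x) (hθx : 0 < θ x)
    (hθ : HasDerivAt θ d x) :
    HasDerivAt (blissWeight p' α θ)
      (-(blissWeight p' α θ x * (1 / p' * ((α + 1) / x + d / θ x)))) x := by
  have hpos : 0 < x ^ (α + 1) * θ x := by positivity
  have h := ((Real.hasDerivAt_rpow_const (p := α + 1) (Or.inl hx.ne')).mul hθ).rpow_const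
    (p := -(1 / p')) (Or.inl hpos.ne')
  refine h.congr_deriv ?_
  simp only [Pi.mul_apply]
  rw [blissWeight, Real.rpow_sub_one hpos.ne', Real.rpow_sub_one hx.ne']
  field_simp

/-- Writing every positive base as an exponential turns the identity into a linear one between
exponents. -/
lemma bliss_amgm_identity (hp : p.HolderConjugate p') (hr : 0 < r) (hq : q = p * (r + 1))
    (hα : α = q / p') {F x y z κ : ℝ} (hF : 0 < F) (hx : 0 < x) (hy : 0 < y) (hz : 0 < z)
    (hκ : 0 < κ) :
    F ^ (α + 1) * ((x ^ (α + 1) * y) ^ (-(1 / p')) * (x⁻¹ ^ ((α + 1) / q) *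
      (F ^ q * x ^ (-(α + 1)) / (κ * (y ^ (1 / r + 1) * z ^ (-(q / r))))) ^ (r / q))) =
      κ ^ (-(r / q)) * (F ^ q * x ^ (-(α + 1)) * (z / y)) := by
  obtain ⟨F, rfl⟩ := Real.range_exp.ge (mem_Ioi.2 hF)
  obtain ⟨x, rfl⟩ := Real.range_exp.ge (mem_Ioi.2 hx)
  obtain ⟨y, rfl⟩ := Real.range_exp.ge (mem_Ioi.2 hy)
  obtain ⟨z, rfl⟩ := Real.range_exp.ge (mem_Ioi.2 hz)
  obtain ⟨κ, rfl⟩ := Real.range_exp.ge (mem_Ioi.2 hκ)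
  simp only [div_eq_mul_inv (Real.exp _), ← Real.exp_mul, ← Real.exp_add,
    ← Real.exp_neg]
  congr 1
  have hp0 := hp.pos.ne'
  rw [hα, hq, hp.conjugate_eq]
  field_simp
  ring

lemma add_one_add_eq_of_conjugate (hp : p.HolderConjugate p') (hq : q = p * (r + 1))
    (hα : α = q / p') : α + 1 + r = q := by
  have hp0 := hp.pos.ne'
  rw [hα, hq, hp.conjugate_eq]
  field_simp
  ring

lemma bliss_amgm (hp : p.HolderConjugate p') (hr : 0 < r) (hq : q = p * (r + 1))
    (hα : α = q / p') {F x y c d : ℝ} (hF : 0 < F) (hx : 0 < x) (hy : 0 < y) (hc : 0 < c)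
    (hd : d = F ^ q * x ^ (-(α + 1)) / (c * betaPrimeDensity (1 / r + 1) (α / r) y)) :
    α * (r * c) ^ (-(r / q)) * (F ^ q * x ^ (-(α + 1)) * ((1 + y) / y)) ≤
      F ^ (α + 1) * ((x ^ (α + 1) * y) ^ (-(1 / p')) * (1 / p' * ((α + 1) / x + d / y))) := by
  have hsum := add_one_add_eq_of_conjugate hp hq hα
  have hp0 := hp.pos
  have hp'0 := hp.symm.pos
  have hq0 : 0 < q := by rw [hq]; positivity
  have hα0 : 0 < α := by rw [hα]; positivity
  have hdy : d / (r * y) = F ^ q * x ^ (-(α + 1)) /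
      (r * c * (y ^ (1 / r + 1) * (1 + y) ^ (-(q / r)))) := by
    rw [hd, betaPrimeDensity, add_sub_cancel_right, Real.rpow_add_one hy.ne',
      show -(q / r) = -(1 / r + 1 + α / r) by rw [← hsum]; field_simp; ring]
    field_simp
  have hd0 : 0 ≤ d / (r * y) := by rw [hdy]; positivity
  have hamgm := Real.geom_mean_le_arith_mean2_weighted (w₁ := (α + 1) / q) (w₂ := r / q)
    (by positivity) (by positivity) (inv_pos.2 hx).le hd0
    (by rw [← add_div, hsum, div_self hq0.ne'])
  calc α * (r * c) ^ (-(r / q)) * (F ^ q * x ^ (-(α + 1)) * ((1 + y) / y))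
      = α * (F ^ (α + 1) * ((x ^ (α + 1) * y) ^ (-(1 / p')) *
          (x⁻¹ ^ ((α + 1) / q) * (d / (r * y)) ^ (r / q)))) := by
        rw [hdy, bliss_amgm_identity hp hr hq hα hF hx hy (by positivity) (mul_pos hr hc)]
        ring
    _ ≤ α * (F ^ (α + 1) * ((x ^ (α + 1) * y) ^ (-(1 / p')) *
          ((α + 1) / q * x⁻¹ + r / q * (d / (r * y))))) := by gcongr
    _ = _ := by
        rw [hα]
        field_simp

lemma mul_blissWeight_rpow (hp : p.HolderConjugate p') (hα : α = q / p') {F x : ℝ} {θ : ℝ → ℝ}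
    (hF : 0 ≤ F) (hx : 0 < x) (hθ : 0 < θ x) :
    (F ^ α * blissWeight p' α θ x) ^ p' = F ^ q * x ^ (-(α + 1)) / θ x := by
  have hp' := hp.symm.pos.ne'
  rw [blissWeight, Real.mul_rpow (by positivity) (by positivity), ← Real.rpow_mul hF,
    ← Real.rpow_mul (by positivity), hα, div_mul_cancel₀ _ hp', neg_mul, one_div_mul_cancel hp',
    Real.rpow_neg_one, Real.rpow_neg hx.le]
  field_simp

end BlissWeight

lemma rpow_one_div_le_of_mul_le {p p' : ℝ} (hp : p.HolderConjugate p') {a b M N : ℝ≥0∞}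
    (ha0 : a ≠ 0) (ha : a ≠ ∞) (hM0 : M ≠ 0) (hM : M ≠ ∞)
    (h : a * M ≤ b * (N * M ^ (1 / p'))) : M ^ (1 / p) ≤ b / a * N := by
  have hX0 : M ^ (1 / p') ≠ 0 := (ENNReal.rpow_pos (pos_iff_ne_zero.2 hM0) hM).ne'
  have hX : M ^ (1 / p') ≠ ∞ := ENNReal.rpow_ne_top_of_ne_zero hM0 hM
  have hsplit : M ^ (1 / p) * M ^ (1 / p') = M := by
    rw [← ENNReal.rpow_add _ _ hM0 hM, one_div, one_div, hp.inv_add_inv_eq_one, ENNReal.rpow_one]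
  rw [← ENNReal.mul_div_right_comm, ENNReal.le_div_iff_mul_le (.inl ha0) (.inl ha), mul_comm,
    ← ENNReal.mul_le_mul_iff_left hX0 hX]
  calc a * M ^ (1 / p) * M ^ (1 / p') = a * M := by rw [mul_assoc, hsplit]
    _ ≤ b * (N * M ^ (1 / p')) := h
    _ = b * N * M ^ (1 / p') := (mul_assoc _ _ _).symm

section BlissWeightRate

variable {p' α : ℝ} {g h θ : ℝ → ℝ}

/-- Minus the derivative of `blissWeight p' α θ` when `θ` transports `g` to `h`. -/
noncomputable def blissWeightRate (p' α : ℝ) (g h θ : ℝ → ℝ) (x : ℝ) : ℝ :=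
  blissWeight p' α θ x * (1 / p' * ((α + 1) / x + g x / h (θ x) / θ x))

namespace IsTransport

lemma blissWeight_pos (hθ : IsTransport g h θ) {x : ℝ} (hx : 0 < x) : 0 < blissWeight p' α θ x :=
  Real.rpow_pos_of_pos (mul_pos (Real.rpow_pos_of_pos hx _) (hθ.pos hx)) _

lemma hasDerivAt_blissWeight (hθ : IsTransport g h θ) {x : ℝ} (hx : 0 < x) :
    HasDerivAt (blissWeight p' α θ) (-blissWeightRate p' α g h θ x) x :=
  _root_.hasDerivAt_blissWeight hx (hθ.pos hx) (hθ.hasDerivAt x hx)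

lemma blissWeightRate_nonneg (hθ : IsTransport g h θ) (hp' : 0 < p') (hα : 0 < α)
    (hg : IsPositiveDensity g) (hh : IsPositiveDensity h) {x : ℝ} (hx : 0 < x) :
    0 ≤ blissWeightRate p' α g h θ x := by
  have hgx := hg.pos x hx
  have hhx := hh.pos _ (hθ.pos hx)
  have hθx := hθ.pos hx
  have hw := hθ.blissWeight_pos (p' := p') (α := α) hx
  rw [blissWeightRate]
  positivity

lemma continuousOn_blissWeightRate (hθ : IsTransport g h θ) (hg : IsPositiveDensity g)
    (hh : IsPositiveDensity h) : ContinuousOn (blissWeightRate p' α g h θ) (Ioi 0) := by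
  refine .mul (fun x hx => (hθ.hasDerivAt_blissWeight hx).continuousAt.continuousWithinAt)
    (continuousOn_const.mul (.add ?_ (.div (.div hg.continuousOn ?_ ?_) hθ.continuousOn ?_)))
  · exact continuousOn_const.div continuousOn_id fun x hx => ne_of_gt hx
  · exact hh.continuousOn.comp hθ.continuousOn fun x hx => hθ.pos hx
  · exact fun x hx => (hh.pos _ (hθ.pos hx)).ne'
  · exact fun x hx => (hθ.pos hx).ne'

end IsTransport

end BlissWeightRate

lemma ofReal_rpow_sub_le_of_rpow_le {a r c B s t : ℝ} (ha : 0 < a) (hr : 0 < r) (hc : 0 < c)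
    (hB : 0 < B) {N : ℝ≥0∞} (h : ENNReal.ofReal (c * B) ^ t ≤
      ENNReal.ofReal a / ENNReal.ofReal (a * (r * c) ^ (-s)) * N) :
    ENNReal.ofReal (c * B) ^ (t - s) ≤ ENNReal.ofReal ((r / B) ^ s) * N := by
  have hcB : 0 < c * B := mul_pos hc hB
  calc ENNReal.ofReal (c * B) ^ (t - s)
      = ENNReal.ofReal (c * B) ^ (-s) * ENNReal.ofReal (c * B) ^ t := by
        rw [sub_eq_neg_add, ENNReal.rpow_add _ _ (by simpa using hcB) ENNReal.ofReal_ne_top]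
    _ ≤ ENNReal.ofReal (c * B) ^ (-s) *
          (ENNReal.ofReal a / ENNReal.ofReal (a * (r * c) ^ (-s)) * N) := by gcongr
    _ = _ := by
        rw [← mul_assoc, ← ENNReal.ofReal_div_of_pos (by positivity),
          ENNReal.ofReal_rpow_of_pos hcB, ← ENNReal.ofReal_mul (by positivity)]
        congr 2
        rw [Real.rpow_neg (by positivity), Real.rpow_neg (by positivity),
          Real.mul_rpow hc.le hB.le, Real.mul_rpow hr.le hc.le, Real.div_rpow hr.le hB.le]
        field_simp

namespace IsPositiveDensity

variable {f : ℝ → ℝ} {L p p' q r α : ℝ}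

lemma lintegral_mul_transport_le_of_bliss (hf : IsPositiveDensity f) (hL : ∀ x > 0, f x ≤ L)
    (hp : p.HolderConjugate p') (hr : 0 < r) (hq : q = p * (r + 1)) (hα : α = q / p') {c : ℝ}
    (hc : 0 < c) {θ : ℝ → ℝ}
    (hθ : IsTransport (fun x => primitive f x ^ q * x ^ (-(α + 1)))
      (fun y => c * betaPrimeDensity (1 / r + 1) (α / r) y) θ) :
    ∫⁻ x in Ioi 0, ENNReal.ofReal (α * (r * c) ^ (-(r / q)) *
        (primitive f x ^ q * x ^ (-(α + 1)) * ((1 + θ x) / θ x))) ≤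
      ENNReal.ofReal (α + 1) * ((∫⁻ x in Ioi 0, ENNReal.ofReal (f x) ^ p) ^ (1 / p) *
        (∫⁻ x in Ioi 0, ENNReal.ofReal (primitive f x ^ q * x ^ (-(α + 1)) / θ x)) ^
          (1 / p')) := by
  have hp0 := hp.pos
  have hp'0 := hp.symm.pos
  have hq0 : 0 < q := by rw [hq]; positivity
  have hα0 : 0 < α := by rw [hα]; positivity
  have hsum := add_one_add_eq_of_conjugate hp hq hα
  have hg := hf.primitive_rpow_mul_rpow hL hq0 (s := α + 1) (by linarith) (by linarith)
  have hh := isPositiveDensity_mul_betaPrimeDensity (a := 1 / r + 1) (b := α / r)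
    (by positivity) (by positivity) hc
  calc _ ≤ ∫⁻ x in Ioi 0, ENNReal.ofReal (primitive f x ^ (α + 1) *
          blissWeightRate p' α (fun x => primitive f x ^ q * x ^ (-(α + 1)))
            (fun y => c * betaPrimeDensity (1 / r + 1) (α / r) y) θ x) :=
        setLIntegral_mono' measurableSet_Ioi fun x hx => ENNReal.ofReal_le_ofReal
          (bliss_amgm hp hr hq hα (hf.primitive_pos hx) hx (hθ.pos hx) hc rfl)
    _ ≤ ENNReal.ofReal (α + 1) * ((∫⁻ x in Ioi 0, ENNReal.ofReal (f x) ^ p) ^ (1 / p) *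
          (∫⁻ x in Ioi 0, ENNReal.ofReal (primitive f x ^ α * blissWeight p' α θ x) ^ p') ^
            (1 / p')) :=
        hf.lintegral_primitive_rpow_mul_le hL hp hα0 (fun x hx => (hθ.blissWeight_pos hx).le)
          (fun x hx => hθ.hasDerivAt_blissWeight hx)
          (fun x hx => hθ.blissWeightRate_nonneg hp'0 hα0 hg hh hx)
          (hθ.continuousOn_blissWeightRate hg hh)
    _ = _ := by
        congr 3
        refine setLIntegral_congr_fun measurableSet_Ioi fun x hx => ?_
        have hF := hf.primitive_pos hx
        have hw := hθ.blissWeight_pos (p' := p') (α := α) hx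
        rw [ENNReal.ofReal_rpow_of_nonneg (by positivity) hp'0.le,
          mul_blissWeight_rpow hp hα hF.le hx (hθ.pos hx)]

lemma ofReal_mul_le_of_bliss (hf : IsPositiveDensity f) (hL : ∀ x > 0, f x ≤ L)
    (hp : p.HolderConjugate p') (hr : 0 < r) (hq : q = p * (r + 1)) (hα : α = q / p') {c M : ℝ}
    (hc : 0 < c) (hm : ∫ x in Ioi 0, primitive f x ^ q * x ^ (-(α + 1)) =
      c * eulerBeta (1 / r + 1) (α / r)) (hM : M = c * eulerBeta (1 / r) (α / r + 1)) :
    ENNReal.ofReal ((α + 1) * (r * c) ^ (-(r / q))) * ENNReal.ofReal M ≤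
      ENNReal.ofReal (α + 1) * ((∫⁻ x in Ioi 0, ENNReal.ofReal (f x) ^ p) ^ (1 / p) *
        ENNReal.ofReal M ^ (1 / p')) := by
  have hp0 := hp.pos
  have hp'0 := hp.symm.pos
  have hq0 : 0 < q := by rw [hq]; positivity
  have hα0 : 0 < α := by rw [hα]; positivity
  have hsum := add_one_add_eq_of_conjugate hp hq hα
  have hr1 : 0 < 1 / r := by positivity
  have hαr : 0 < α / r := by positivity
  have hg := hf.primitive_rpow_mul_rpow hL hq0 (s := α + 1) (by linarith) (by linarith)
  have hh := isPositiveDensity_mul_betaPrimeDensity (add_pos hr1 one_pos) hαr hc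
  obtain ⟨θ, hθ⟩ := exists_isTransport hg hh (by
    rw [hm, integral_mul_betaPrimeDensity (add_pos hr1 one_pos) hαr hc])
  calc ENNReal.ofReal ((α + 1) * (r * c) ^ (-(r / q))) * ENNReal.ofReal M
      = ENNReal.ofReal (α * (r * c) ^ (-(r / q))) *
          ENNReal.ofReal (c * eulerBeta (1 / r) (α / r)) := by
        rw [← ENNReal.ofReal_mul (by positivity), ← ENNReal.ofReal_mul (by positivity), hM]
        congr 1
        rw [eulerBeta_add_one_right hr1 hαr]
        field_simp
        ring
    _ = ∫⁻ x in Ioi 0, ENNReal.ofReal (α * (r * c) ^ (-(r / q)) *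
          (primitive f x ^ q * x ^ (-(α + 1)) * ((1 + θ x) / θ x))) := by
        rw [← lintegral_mul_transport_betaPrime hr1 hαr hc (fun x hx => (hg.pos x hx).le) hθ,
          ← lintegral_const_mul' _ _ ENNReal.ofReal_ne_top]
        simp_rw [← ENNReal.ofReal_mul (show 0 ≤ α * (r * c) ^ (-(r / q)) by positivity)]
    _ ≤ _ := hf.lintegral_mul_transport_le_of_bliss hL hp hr hq hα hc hθ
    _ = _ := by
        rw [lintegral_div_transport_betaPrime hr1 hαr hc (fun x hx => (hg.pos x hx).le) hθ, hM]

lemma bliss_inequality (hf : IsPositiveDensity f) (hL : ∀ x > 0, f x ≤ L)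
    (hp : p.HolderConjugate p') (hr : 0 < r) (hq : q = p * (r + 1)) (hα : α = q / p') :
    ENNReal.ofReal (α * ∫ x in Ioi 0, primitive f x ^ q * x ^ (-(α + 1))) ^ (1 / q) ≤
      ENNReal.ofReal ((r / eulerBeta (1 / r) (α / r + 1)) ^ (1 / p - 1 / q)) *
        (∫⁻ x in Ioi 0, ENNReal.ofReal (f x) ^ p) ^ (1 / p) := by
  have hp0 := hp.pos
  have hp'0 := hp.symm.pos
  have hq0 : 0 < q := by rw [hq]; positivity
  have hα0 : 0 < α := by rw [hα]; positivity
  have hsum := add_one_add_eq_of_conjugate hp hq hα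
  have hr1 : 0 < 1 / r := by positivity
  have hαr : 0 < α / r := by positivity
  have hm := (hf.primitive_rpow_mul_rpow hL hq0 (s := α + 1) (by linarith)
    (by linarith)).integral_pos
  set m := ∫ x in Ioi 0, primitive f x ^ q * x ^ (-(α + 1))
  have hB := eulerBeta_pos hr1 (b := α / r + 1) (by positivity)
  have hB' := eulerBeta_pos (a := 1 / r + 1) (by positivity) hαr
  set B := eulerBeta (1 / r) (α / r + 1) with hBdef
  set c := m / eulerBeta (1 / r + 1) (α / r)
  have hc : 0 < c := div_pos hm hB'
  have hmc : m = c * eulerBeta (1 / r + 1) (α / r) := (div_mul_cancel₀ m hB'.ne').symm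
  have hM : α * m = c * B := by
    rw [hmc, hBdef, eulerBeta_add_one_left hr1 hαr, eulerBeta_add_one_right hr1 hαr]
    field_simp
  have hexp : 1 / q = 1 / p - r / q := by
    rw [hq]
    field_simp
    ring
  have hle := rpow_one_div_le_of_mul_le hp (ENNReal.ofReal_pos.2 (by positivity)).ne'
    ENNReal.ofReal_ne_top (ENNReal.ofReal_pos.2 (by positivity)).ne' ENNReal.ofReal_ne_top
    (hf.ofReal_mul_le_of_bliss hL hp hr hq hα hc hmc hM)
  rw [show 1 / p - 1 / q = r / q by rw [hexp]; ring, hexp, hM]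
  rw [hM] at hle
  exact ofReal_rpow_sub_le_of_rpow_le (by positivity) hr hc hB hle

lemma hardy_inequality (hf : IsPositiveDensity f) (hL : ∀ x > 0, f x ≤ L)
    (hp : p.HolderConjugate p') :
    ENNReal.ofReal ((p - 1) * ∫ x in Ioi 0, primitive f x ^ p * x ^ (-p)) ^ (1 / p) ≤
      ENNReal.ofReal ((p - 1) ^ (1 / p) * (p / (p - 1))) *
        (∫⁻ x in Ioi 0, ENNReal.ofReal (f x) ^ p) ^ (1 / p) := by
  have hp0 := hp.pos
  have hp1 := hp.sub_one_pos
  have hg := hf.primitive_rpow_mul_rpow hL hp0 hp.lt (lt_add_one p)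
  have hm := hg.integral_pos
  have hmass := hg.lintegral_eq
  set m := ∫ x in Ioi 0, primitive f x ^ p * x ^ (-p)
  have hle : ENNReal.ofReal (p - 1) * ENNReal.ofReal m ≤ ENNReal.ofReal p *
      ((∫⁻ x in Ioi 0, ENNReal.ofReal (f x) ^ p) ^ (1 / p) * ENNReal.ofReal m ^ (1 / p')) := by
    have h := hf.lintegral_primitive_rpow_mul_le hL hp hp1 (w := fun x => x ^ (-(p - 1)))
      (v := fun x => (p - 1) * x ^ (-p)) (fun x hx => Real.rpow_nonneg hx.le _)
      (fun x hx => ?_) (fun x hx => mul_nonneg hp1.le (Real.rpow_nonneg hx.le _))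
      (continuousOn_const.mul (continuousOn_id.rpow_const fun x hx => Or.inl (ne_of_gt hx)))
    · rw [sub_add_cancel] at h
      convert h using 1
      · rw [← hmass, ← lintegral_const_mul' _ _ ENNReal.ofReal_ne_top]
        simp_rw [← ENNReal.ofReal_mul hp1.le, mul_left_comm]
      · rw [← hmass]
        congr 3
        refine setLIntegral_congr_fun measurableSet_Ioi fun x (hx : 0 < x) => ?_
        have hF := hf.primitive_pos hx
        rw [ENNReal.ofReal_rpow_of_nonneg (by positivity) hp.symm.pos.le,
          Real.mul_rpow (by positivity) (by positivity), ← Real.rpow_mul hF.le,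
          ← Real.rpow_mul hx.le, neg_mul, hp.sub_one_mul_conj]
    · refine (Real.hasDerivAt_rpow_const (Or.inl hx.ne')).congr_deriv ?_
      rw [show -(p - 1) - 1 = -p by ring]
      ring
  have hroot := rpow_one_div_le_of_mul_le hp (ENNReal.ofReal_pos.2 hp1).ne' ENNReal.ofReal_ne_top
    (by simpa using hm) ENNReal.ofReal_ne_top hle
  rw [ENNReal.ofReal_mul hp1.le, ENNReal.mul_rpow_of_nonneg _ _ (by positivity),
    ENNReal.ofReal_mul (by positivity), ENNReal.ofReal_div_of_pos hp1,
    ← ENNReal.ofReal_rpow_of_pos hp1, mul_assoc]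
  gcongr

end IsPositiveDensity

/-! ### Bliss's inequality on the half-line -/

lemma sharpFactor_self {p : ℝ} (hp : 1 < p) :
    sharpFactor p p = (p - 1) ^ (1 / p) * (p / (p - 1)) := by
  have hp0 : 0 < p := by linarith
  have hp1 : 0 < p - 1 := by linarith
  have hconj : 1 / (p / (p - 1)) = 1 - 1 / p := by field_simp
  rw [sharpFactor, if_pos rfl, Real.conjExponent, hconj, Real.rpow_sub (by positivity),
    Real.rpow_one, Real.div_rpow hp0.le hp1.le]
  field_simp

lemma sharpFactor_of_lt {p q : ℝ} (hp : 1 < p) (hpq : p < q) :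
    sharpFactor q p = ((q / p - 1) / eulerBeta (1 / (q / p - 1))
      (q / p.conjExponent / (q / p - 1) + 1)) ^ (1 / p - 1 / q) := by
  have hp0 : 0 < p := by linarith
  have hr : 0 < q / p - 1 := sub_pos.2 ((one_lt_div hp0).2 hpq)
  rw [sharpFactor, if_neg hpq.ne]
  congr 3
  rw [div_add_one hr.ne', Real.conjExponent]
  congr 1
  field_simp
  ring

lemma sharpFactor_pos {p q : ℝ} (hp : 1 < p) (hpq : p ≤ q) : 0 < sharpFactor q p := by
  have hp0 : 0 < p := by linarith
  rcases hpq.eq_or_lt with rfl | hlt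
  · rw [sharpFactor_self hp]
    positivity
  · have hr : 0 < q / p - 1 := sub_pos.2 ((one_lt_div hp0).2 hlt)
    have hq : 0 < q - 1 := by linarith
    rw [sharpFactor, if_neg hlt.ne]
    exact Real.rpow_pos_of_pos (div_pos hr (eulerBeta_pos (by positivity) (by positivity))) _

/-- The measure on `(0, ∞)` with tail `μ((a, ∞)) = a ^ (-α)`. -/
noncomputable def powerTail (α : ℝ) : Measure ℝ :=
  (volume.restrict (Ioi 0)).withDensity fun t => ENNReal.ofReal (α * t ^ (-(α + 1)))

lemma ae_powerTail_mem_Ioi (α : ℝ) : ∀ᵐ x ∂powerTail α, x ∈ Ioi (0 : ℝ) :=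
  (withDensity_absolutelyContinuous _ _).ae_le (ae_restrict_mem measurableSet_Ioi)

lemma lintegral_powerTail (α : ℝ) (f : ℝ → ℝ≥0∞) :
    ∫⁻ x, f x ∂powerTail α = ∫⁻ x in Ioi 0, ENNReal.ofReal (α * x ^ (-(α + 1))) * f x :=
  lintegral_withDensity_eq_lintegral_mul_non_measurable _ (by fun_prop)
    (ae_of_all _ fun _ => ENNReal.ofReal_lt_top) f

lemma eLpNorm_ofReal_eq_lintegral_rpow {X : Type*} [MeasurableSpace X] {μ : Measure X} {f : X → ℝ}
    {p : ℝ} (hp : 0 < p) (hf : 0 ≤ᵐ[μ] f) :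
    eLpNorm f (ENNReal.ofReal p) μ = (∫⁻ x, ENNReal.ofReal (f x) ^ p ∂μ) ^ (1 / p) := by
  rw [eLpNorm_eq_lintegral_rpow_enorm_toReal (ENNReal.ofReal_pos.2 hp).ne' ENNReal.ofReal_ne_top,
    ENNReal.toReal_ofReal hp.le]
  congr 1
  exact lintegral_congr_ae (hf.mono fun x hx => by simp only [Real.enorm_of_nonneg hx])

namespace IsPositiveDensity

variable {f : ℝ → ℝ} {L p q α : ℝ}

lemma lintegral_primitive_rpow_powerTail (hf : IsPositiveDensity f) (hq : 0 ≤ q) (hα : 0 ≤ α)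
    (hF : IsPositiveDensity fun x => primitive f x ^ q * x ^ (-(α + 1))) :
    ∫⁻ x, ENNReal.ofReal (primitive f x) ^ q ∂powerTail α =
      ENNReal.ofReal (α * ∫ x in Ioi 0, primitive f x ^ q * x ^ (-(α + 1))) := by
  rw [lintegral_powerTail, ENNReal.ofReal_mul hα, ← hF.lintegral_eq,
    ← lintegral_const_mul' _ _ ENNReal.ofReal_ne_top]
  refine setLIntegral_congr_fun measurableSet_Ioi fun x hx => ?_
  rw [ENNReal.ofReal_rpow_of_nonneg (hf.primitive_pos hx).le hq, ENNReal.ofReal_mul hα,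
    ENNReal.ofReal_mul (Real.rpow_nonneg (hf.primitive_pos hx).le _), mul_assoc,
    mul_comm (ENNReal.ofReal (x ^ _))]

lemma eLpNorm_primitive_le (hf : IsPositiveDensity f) (hL : ∀ x > 0, f x ≤ L) (hp : 1 < p)
    (hpq : p ≤ q) :
    eLpNorm (primitive f) (ENNReal.ofReal q) (powerTail (q / p.conjExponent)) ≤
      ENNReal.ofReal (sharpFactor q p) *
        eLpNorm f (ENNReal.ofReal p) (volume.restrict (Ioi 0)) := by
  have hp' := Real.HolderConjugate.conjExponent hp
  have hp0 := hp'.pos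
  have hp'0 := hp'.symm.pos
  have hq0 : 0 < q := hp0.trans_le hpq
  have hα : 0 < q / p.conjExponent := by positivity
  have hα1 : q / p.conjExponent + 1 < q + 1 :=
    add_lt_add_left (div_lt_self hq0 hp'.symm.lt) 1
  rw [eLpNorm_ofReal_eq_lintegral_rpow hq0
      ((ae_powerTail_mem_Ioi _).mono fun x hx => (hf.primitive_pos hx).le),
    hf.lintegral_primitive_rpow_powerTail hq0.le hα.le
      (hf.primitive_rpow_mul_rpow hL hq0 (by linarith) hα1),
    eLpNorm_ofReal_eq_lintegral_rpow hp0
      ((ae_restrict_mem measurableSet_Ioi).mono fun x hx => (hf.pos x hx).le)]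
  rcases hpq.eq_or_lt with rfl | hlt
  · have hα_eq : p / p.conjExponent = p - 1 := by
      rw [Real.conjExponent, div_div_cancel₀ hp0.ne']
    rw [hα_eq, sharpFactor_self hp, sub_add_cancel]
    exact hf.hardy_inequality hL hp'
  · rw [sharpFactor_of_lt hp hlt]
    exact hf.bliss_inequality hL hp' (sub_pos.2 ((one_lt_div hp0).2 hlt))
      (by rw [sub_add_cancel, mul_div_cancel₀ _ hp0.ne']) rfl

end IsPositiveDensity

section HalfLine

lemma memLp_exp_neg_Ioi {p : ℝ≥0∞} (hp0 : p ≠ 0) (hp : p ≠ ∞) :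
    MemLp (fun x : ℝ => Real.exp (-x)) p (volume.restrict (Ioi 0)) := by
  rw [← integrable_norm_rpow_iff (by fun_prop) hp0 hp]
  refine (exp_neg_integrableOn_Ioi 0 (ENNReal.toReal_pos hp0 hp)).congr (ae_of_all _ fun x => ?_)
  simp only [Real.norm_of_nonneg (Real.exp_pos _).le]
  rw [← Real.exp_mul, neg_mul, neg_mul, mul_comm]

lemma isPositiveDensity_abs_add_exp {g : ℝ → ℝ} (hg : Continuous g) (hgs : HasCompactSupport g)
    {ε : ℝ} (hε : 0 < ε) : IsPositiveDensity fun x => |g x| + ε * Real.exp (-x) where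
  continuousOn := by fun_prop
  pos x _ := by positivity
  integrableOn := (hg.integrable_of_hasCompactSupport hgs).abs.integrableOn.add
    ((memLp_one_iff_integrable.1 (memLp_exp_neg_Ioi one_ne_zero ENNReal.one_ne_top)).const_mul ε)

lemma exists_isPositiveDensity_eLpNorm_sub_le {p : ℝ≥0∞} (hp1 : 1 ≤ p) (hp : p ≠ ∞) {f : ℝ → ℝ}
    (hf : MemLp f p (volume.restrict (Ioi 0))) (hf0 : ∀ x, 0 ≤ f x) {δ : ℝ≥0∞} (hδ : δ ≠ 0) :
    ∃ h, IsPositiveDensity h ∧ (∃ L, ∀ x > 0, h x ≤ L) ∧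
      MemLp h p (volume.restrict (Ioi 0)) ∧ eLpNorm (h - f) p (volume.restrict (Ioi 0)) ≤ δ := by
  have hδ2 : δ / 2 ≠ 0 := by simpa using hδ
  obtain ⟨g, hgs, hge, hgc, hgm⟩ := hf.exists_hasCompactSupport_eLpNorm_sub_le hp hδ2
  obtain ⟨C, hC⟩ := hgc.bounded_above_of_compact_support hgs
  have hG := memLp_exp_neg_Ioi (p := p) (by positivity) hp
  obtain ⟨ε, hε, hεle⟩ := ENNReal.exists_nnreal_pos_mul_lt hG.eLpNorm_ne_top hδ2
  have hGε := hG.const_mul (ε : ℝ)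
  refine ⟨fun x => |g x| + ε * Real.exp (-x), isPositiveDensity_abs_add_exp hgc hgs hε,
    ⟨C + ε, fun x hx => ?_⟩, hgm.norm.add hGε, ?_⟩
  · have hexp : Real.exp (-x) ≤ 1 := Real.exp_le_one_iff.2 (by linarith)
    exact add_le_add (hC x) (mul_le_of_le_one_right ε.2 hexp)
  have hsplit : (fun x => |g x| + ε * Real.exp (-x)) - f =
      (fun x => |g x| - f x) + fun x => ε * Real.exp (-x) := by
    ext x
    simp only [Pi.sub_apply, Pi.add_apply]
    ring
  rw [hsplit, ← ENNReal.add_halves δ]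
  refine (eLpNorm_add_le (hgm.norm.sub hf).1 hGε.1 hp1).trans (add_le_add ?_ ?_)
  · refine (eLpNorm_mono fun x => ?_).trans hge
    have hle := abs_abs_sub_abs_le_abs_sub (g x) (f x)
    rwa [abs_of_nonneg (hf0 x), abs_sub_comm (g x)] at hle
  · refine (eLpNorm_const_smul (ε : ℝ) (fun x : ℝ => Real.exp (-x)) p _).trans_le ?_
    simpa using hεle.le

lemma tendsto_integral_of_tendsto_eLpNorm_sub {X ι E : Type*} [MeasurableSpace X]
    [NormedAddCommGroup E] [NormedSpace ℝ E] {μ : Measure X} [IsFiniteMeasure μ] {l : Filter ι}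
    {p : ℝ≥0∞} (hp : 1 ≤ p) {F : ι → X → E} {f : X → E} (hf : MemLp f p μ)
    (hF : ∀ i, MemLp (F i) p μ) (h : Tendsto (fun i => eLpNorm (F i - f) p μ) l (𝓝 0)) :
    Tendsto (fun i => ∫ x, F i x ∂μ) l (𝓝 (∫ x, f x ∂μ)) := by
  set C := μ univ ^ (1 / (1 : ℝ≥0∞).toReal - 1 / p.toReal)
  have hC : C ≠ ∞ := by
    refine ENNReal.rpow_ne_top_of_nonneg ?_ (measure_ne_top _ _)
    rcases eq_or_ne p ∞ with rfl | hptop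
    · simp
    · simpa using inv_le_one_of_one_le₀ (ENNReal.toReal_mono hptop hp)
  refine tendsto_integral_of_L1' f hf.1 (.of_forall fun i => (hF i).integrable hp)
    (tendsto_of_tendsto_of_tendsto_of_le_of_le tendsto_const_nhds
      (by simpa only [zero_mul] using ENNReal.Tendsto.mul_const h (.inr hC)) (fun _ => zero_le)
      fun i => eLpNorm_le_eLpNorm_mul_rpow_measure_univ hp ((hF i).sub hf).1)

lemma tendsto_primitive_of_tendsto_eLpNorm_sub {ι : Type*} {l : Filter ι} {p : ℝ≥0∞} (hp : 1 ≤ p)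
    {F : ι → ℝ → ℝ} {f : ℝ → ℝ} (hf : MemLp f p (volume.restrict (Ioi 0)))
    (hF : ∀ i, MemLp (F i) p (volume.restrict (Ioi 0)))
    (h : Tendsto (fun i => eLpNorm (F i - f) p (volume.restrict (Ioi 0))) l (𝓝 0)) {x : ℝ}
    (hx : 0 ≤ x) : Tendsto (fun i => primitive (F i) x) l (𝓝 (primitive f x)) := by
  have hμ : volume.restrict (Ioc 0 x) ≤ volume.restrict (Ioi (0 : ℝ)) :=
    Measure.restrict_mono_set _ Ioc_subset_Ioi_self
  simp only [primitive, intervalIntegral.integral_of_le hx]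
  exact tendsto_integral_of_tendsto_eLpNorm_sub hp (hf.mono_measure hμ)
    (fun i => (hF i).mono_measure hμ) (tendsto_of_tendsto_of_tendsto_of_le_of_le
      tendsto_const_nhds h (fun _ => zero_le) fun i => eLpNorm_mono_measure _ hμ)

variable {p q : ℝ}

lemma eLpNorm_primitive_le_of_memLp (hp : 1 < p) (hpq : p ≤ q) {f : ℝ → ℝ}
    (hf : MemLp f (ENNReal.ofReal p) (volume.restrict (Ioi 0))) (hf0 : ∀ x, 0 ≤ f x) :
    eLpNorm (primitive f) (ENNReal.ofReal q) (powerTail (q / p.conjExponent)) ≤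
      ENNReal.ofReal (sharpFactor q p) *
        eLpNorm f (ENNReal.ofReal p) (volume.restrict (Ioi 0)) := by
  have hp1 : 1 ≤ ENNReal.ofReal p := ENNReal.one_le_ofReal.2 hp.le
  choose h hpos hbdd hmem hle using fun n : ℕ =>
    exists_isPositiveDensity_eLpNorm_sub_le hp1 ENNReal.ofReal_ne_top hf hf0
      (ENNReal.inv_ne_zero.2 (ENNReal.natCast_ne_top n))
  choose L hL using hbdd
  have hδ := ENNReal.tendsto_inv_nat_nhds_zero
  have hlim := tendsto_of_tendsto_of_tendsto_of_le_of_le tendsto_const_nhds hδ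
    (fun _ => zero_le) hle
  have hbound (n : ℕ) :
      eLpNorm (primitive (h n)) (ENNReal.ofReal q) (powerTail (q / p.conjExponent)) ≤
        ENNReal.ofReal (sharpFactor q p) *
          (eLpNorm f (ENNReal.ofReal p) (volume.restrict (Ioi 0)) + (n : ℝ≥0∞)⁻¹) := by
    refine ((hpos n).eLpNorm_primitive_le (hL n) hp hpq).trans ?_
    gcongr
    rw [← add_sub_cancel f (h n)]
    exact (eLpNorm_add_le hf.1 ((hmem n).sub hf).1 hp1).trans (by gcongr; exact hle n)
  have htend := ENNReal.Tendsto.const_mul (hδ.const_add (eLpNorm f (ENNReal.ofReal p)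
    (volume.restrict (Ioi 0)))) (.inr (ENNReal.ofReal_ne_top (r := sharpFactor q p)))
  rw [add_zero] at htend
  refine (Lp.eLpNorm_lim_le_liminf_eLpNorm (fun n => ?_) _ ?_).trans
    ((liminf_le_liminf (.of_forall hbound)).trans_eq htend.liminf_eq)
  · exact ((hpos n).continuousOn_primitive.aestronglyMeasurable measurableSet_Ioi).mono_ac
      (withDensity_absolutelyContinuous _ _)
  · exact (ae_powerTail_mem_Ioi _).mono fun x hx =>
      tendsto_primitive_of_tendsto_eLpNorm_sub hp1 hf hmem hlim (le_of_lt hx)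

lemma ofReal_primitive_toReal {r : ℝ≥0∞} (hr : 1 ≤ r) {f : ℝ → ℝ≥0∞}
    (hf : MemLp (fun y => (f y).toReal) r (volume.restrict (Ioi 0)))
    (hfin : ∀ᵐ y ∂volume.restrict (Ioi (0 : ℝ)), f y < ∞) {x : ℝ} (hx : 0 ≤ x) :
    ENNReal.ofReal (primitive (fun y => (f y).toReal) x) = ∫⁻ y in Ioc 0 x, f y := by
  have hμ : volume.restrict (Ioc 0 x) ≤ volume.restrict (Ioi (0 : ℝ)) :=
    Measure.restrict_mono_set _ Ioc_subset_Ioi_self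
  rw [primitive, intervalIntegral.integral_of_le hx, ofReal_integral_eq_lintegral_ofReal
    ((hf.mono_measure hμ).integrable hr) (ae_of_all _ fun _ => ENNReal.toReal_nonneg)]
  have hfin' : ∀ᵐ y ∂volume.restrict (Ioc 0 x), f y < ∞ := ae_mono hμ hfin
  exact lintegral_congr_ae (hfin'.mono fun _ hy => ENNReal.ofReal_toReal hy.ne)

theorem lintegral_Ioc_rpow_powerTail_le (hp : 1 < p) (hpq : p ≤ q) {f : ℝ → ℝ≥0∞}
    (hf : Measurable f) :
    (∫⁻ x, (∫⁻ y in Ioc 0 x, f y) ^ q ∂powerTail (q / p.conjExponent)) ^ (1 / q) ≤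
      ENNReal.ofReal (sharpFactor q p) * (∫⁻ y in Ioi 0, f y ^ p) ^ (1 / p) := by
  have hp0 : 0 < p := by linarith
  have hq0 : 0 < q := by linarith
  rcases eq_or_ne (∫⁻ y in Ioi 0, f y ^ p) ∞ with htop | htop
  · rw [htop, ENNReal.top_rpow_of_pos (by positivity),
      ENNReal.mul_top (ENNReal.ofReal_pos.2 (sharpFactor_pos hp hpq)).ne']
    exact le_top
  have hfin : ∀ᵐ y ∂volume.restrict (Ioi (0 : ℝ)), f y < ∞ :=
    (ae_lt_top (hf.pow_const p) htop).mono fun y hy => (ENNReal.rpow_lt_top_iff_of_pos hp0).1 hy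
  have hnorm : eLpNorm (fun y => (f y).toReal) (ENNReal.ofReal p) (volume.restrict (Ioi 0)) =
      (∫⁻ y in Ioi 0, f y ^ p) ^ (1 / p) := by
    rw [eLpNorm_ofReal_eq_lintegral_rpow hp0 (ae_of_all _ fun _ => ENNReal.toReal_nonneg)]
    congr 1
    exact lintegral_congr_ae (hfin.mono fun y hy => by simp only [ENNReal.ofReal_toReal hy.ne])
  have hmem : MemLp (fun y => (f y).toReal) (ENNReal.ofReal p) (volume.restrict (Ioi 0)) :=
    ⟨hf.ennreal_toReal.aestronglyMeasurable, by
      rw [hnorm]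
      exact ENNReal.rpow_lt_top_of_nonneg (by positivity) htop⟩
  have hprim : 0 ≤ᵐ[powerTail (q / p.conjExponent)] primitive fun y => (f y).toReal :=
    (ae_powerTail_mem_Ioi _).mono fun x hx =>
      intervalIntegral.integral_nonneg (le_of_lt hx) fun _ _ => ENNReal.toReal_nonneg
  have hle := eLpNorm_primitive_le_of_memLp hp hpq hmem fun _ => ENNReal.toReal_nonneg
  rw [hnorm, eLpNorm_ofReal_eq_lintegral_rpow hq0 hprim] at hle
  refine le_of_eq_of_le (congrArg (· ^ (1 / q)) (lintegral_congr_ae ?_)) hle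
  refine (ae_powerTail_mem_Ioi _).mono fun x hx => ?_
  simp only [ofReal_primitive_toReal (ENNReal.one_le_ofReal.2 hp.le) hmem hfin (le_of_lt hx)]

end HalfLine

/-! ### Quantile functions -/

section Quantile

variable {ν ν' : Measure ℝ} {T : ℝ → ℝ} {α x : ℝ}

lemma cumul_mono (ν : Measure ℝ) : Monotone (cumul ν) :=
  fun _ _ h => measure_mono (Iic_subset_Iic.2 h)

lemma measurableSet_cumul_lt_top (ν : Measure ℝ) : MeasurableSet {y | cumul ν y < ∞} :=
  measurableSet_lt (cumul_mono ν).measurable measurable_const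

lemma tendsto_cumul_atBot (hfin : ∃ x, cumul ν x < ∞) : Tendsto (cumul ν) atBot (𝓝 0) := by
  obtain ⟨x₀, hx₀⟩ := hfin
  have h := tendsto_measure_iInter_atBot (μ := ν) (s := fun x : ℝ => Iic x)
    (fun x => measurableSet_Iic.nullMeasurableSet) (fun _ _ h => Iic_subset_Iic.2 h)
    ⟨x₀, hx₀.ne⟩
  rwa [iInter_Iic_eq_empty_iff.2 (by simp), measure_empty] at h

lemma tendsto_cumul_nhdsGT (h : ∃ y > x, cumul ν y < ∞) :
    Tendsto (cumul ν) (𝓝[>] x) (𝓝 (cumul ν x)) := by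
  obtain ⟨y, hy, hyfin⟩ := h
  have hlim := tendsto_measure_biInter_gt (μ := ν) (s := fun x : ℝ => Iic x) (a := x)
    (fun x _ => measurableSet_Iic.nullMeasurableSet) (fun _ _ _ h => Iic_subset_Iic.2 h)
    ⟨y, hy, hyfin.ne⟩
  have hinter : ⋂ z > x, Iic z = Iic x := by
    ext z
    simp only [mem_iInter, mem_Iic]
    exact ⟨le_of_forall_gt_imp_ge_of_dense, fun h y hy => h.trans (le_of_lt hy)⟩
  rwa [hinter] at hlim

/-- `T` is a quantile function of `ν`: on `(0, ∞)` it is the generalized inverse of `cumul ν`. Its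
values on `(-∞, 0]` are irrelevant. -/
structure IsQuantile (ν : Measure ℝ) (T : ℝ → ℝ) : Prop where
  measurable : Measurable T
  le_iff : ∀ s > 0, ∀ x, T s ≤ x ↔ ENNReal.ofReal s ≤ cumul ν x

lemma isQuantile_indicator_of_forall_le_iff
    (hT : ∀ s > 0, ∀ x, T s ≤ x ↔ ENNReal.ofReal s ≤ cumul ν x) :
    IsQuantile ν (indicator (Ioi 0) T) where
  measurable := by
    refine measurable_of_Iic fun x => ?_
    have hpre : indicator (Ioi 0) T ⁻¹' Iic x =
        (Ioi 0 ∩ {s | ENNReal.ofReal s ≤ cumul ν x}) ∪ (Iic 0 ∩ {_s | 0 ≤ x}) := by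
      ext s
      rcases lt_or_ge 0 s with hs | hs
      · simp [hs, hT s hs x]
      · simp [hs, not_lt.2 hs]
    rw [hpre]
    exact (measurableSet_Ioi.inter (measurableSet_le ENNReal.measurable_ofReal
      measurable_const)).union (measurableSet_Iic.inter (MeasurableSet.const _))
  le_iff s hs x := by rw [indicator_of_mem (mem_Ioi.2 hs), hT s hs x]

lemma exists_isQuantile (hS : Tendsto (cumul ν) atTop (𝓝 ∞)) (hfin : ∃ x, cumul ν x < ∞)
    (hright : ∀ x, cumul ν x < ∞ → ∃ y > x, cumul ν y < ∞) : ∃ T, IsQuantile ν T := by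
  refine ⟨_, isQuantile_indicator_of_forall_le_iff
    (T := fun s => sInf {x | ENNReal.ofReal s ≤ cumul ν x}) fun s hs x => ?_⟩
  have hbdd : BddBelow {x | ENNReal.ofReal s ≤ cumul ν x} := by
    obtain ⟨b, hb⟩ := ((tendsto_cumul_atBot hfin).eventually
      (Iio_mem_nhds (ENNReal.ofReal_pos.2 hs))).exists
    exact ⟨b, fun x hx => le_of_not_gt fun hlt =>
      absurd ((cumul_mono ν hlt.le).trans_lt hb) (not_lt.2 hx)⟩
  refine ⟨fun h => le_trans ?_ (cumul_mono ν h), fun h => csInf_le hbdd h⟩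
  set t := sInf {x | ENNReal.ofReal s ≤ cumul ν x}
  rcases eq_or_ne (cumul ν t) ∞ with htop | htop
  · exact htop ▸ le_top
  · refine ge_of_tendsto (tendsto_cumul_nhdsGT (hright t htop.lt_top)) ?_
    filter_upwards [self_mem_nhdsWithin] with x hx
    obtain ⟨z, hz, hzx⟩ := exists_lt_of_csInf_lt
      (hS.eventually (Ici_mem_nhds ENNReal.ofReal_lt_top)).exists hx
    exact le_trans hz (cumul_mono ν hzx.le)

lemma volume_Ioi_inter_ofReal_le (S : ℝ≥0∞) : volume (Ioi 0 ∩ {s | ENNReal.ofReal s ≤ S}) = S := by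
  induction S with
  | top => simp
  | coe S =>
    have hset : Ioi 0 ∩ {s | ENNReal.ofReal s ≤ (S : ℝ≥0∞)} = Ioc 0 (S : ℝ) := by
      ext s
      simp only [mem_inter_iff, mem_ofPred_eq, mem_Ioi, mem_Ioc]
      rw [← ENNReal.ofReal_coe_nnreal, ENNReal.ofReal_le_ofReal_iff S.coe_nonneg]
    rw [hset, Real.volume_Ioc, sub_zero, ENNReal.ofReal_coe_nnreal]

lemma powerTail_Ioi {a : ℝ} (hα : 0 < α) (ha : 0 < a) :
    powerTail α (Ioi a) = ENNReal.ofReal a ^ (-α) := by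
  have hlt : -(α + 1) < -1 := by linarith
  have hint : IntegrableOn (fun t : ℝ => α * t ^ (-(α + 1))) (Ioi a) :=
    (integrableOn_Ioi_rpow_of_lt hlt ha).const_mul α
  rw [powerTail, withDensity_apply _ measurableSet_Ioi, Measure.restrict_restrict
    measurableSet_Ioi, Ioi_inter_Ioi, max_eq_left ha.le, ENNReal.ofReal_rpow_of_pos ha,
    ← ofReal_integral_eq_lintegral_ofReal hint, integral_const_mul,
    integral_Ioi_rpow_of_lt hlt ha]
  · rw [neg_add, neg_add_cancel_right]
    field_simp
  · filter_upwards [ae_restrict_mem measurableSet_Ioi] with t ht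
    have ht0 : 0 < t := ha.trans ht
    simp only [Pi.zero_apply]
    positivity

lemma powerTail_Ioi_zero (hα : 0 < α) : powerTail α (Ioi 0) = ∞ := by
  have hlim : Tendsto (fun a : ℝ => ENNReal.ofReal a ^ (-α)) (𝓝[>] 0) (𝓝 ∞) := by
    have h := ((ENNReal.continuous_rpow_const (y := -α)).comp ENNReal.continuous_ofReal).tendsto 0
    simp only [Function.comp_def, ENNReal.ofReal_zero,
      ENNReal.zero_rpow_of_neg (neg_lt_zero.2 hα)] at h
    exact h.mono_left nhdsWithin_le_nhds
  refine top_le_iff.1 (le_of_tendsto hlim ?_)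
  filter_upwards [self_mem_nhdsWithin] with a ha
  rw [← powerTail_Ioi hα ha]
  exact measure_mono (Ioi_subset_Ioi (le_of_lt ha))

lemma powerTail_lt_ofReal (hα : 0 < α) (S : ℝ≥0∞) :
    powerTail α {s | S < ENNReal.ofReal s} = S ^ (-α) := by
  induction S with
  | top => simp [hα]
  | coe S =>
    have hset : {s | (S : ℝ≥0∞) < ENNReal.ofReal s} = Ioi (S : ℝ) := by
      ext s
      rw [mem_ofPred_eq, mem_Ioi, ← ENNReal.ofReal_coe_nnreal,
        ENNReal.ofReal_lt_ofReal_iff_of_nonneg S.coe_nonneg]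
    rw [hset]
    rcases eq_zero_or_pos S with rfl | hpos
    · rw [NNReal.coe_zero, powerTail_Ioi_zero hα, ENNReal.coe_zero,
        ENNReal.zero_rpow_of_neg (neg_lt_zero.2 hα)]
    · rw [powerTail_Ioi hα (NNReal.coe_pos.2 hpos), ENNReal.ofReal_coe_nnreal]

namespace IsQuantile

lemma map_volume_Iic (hT : IsQuantile ν T) (x : ℝ) :
    (volume.restrict (Ioi 0)).map T (Iic x) = cumul ν x := by
  rw [Measure.map_apply hT.measurable measurableSet_Iic,
    Measure.restrict_apply (hT.measurable measurableSet_Iic), inter_comm,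
    ← volume_Ioi_inter_ofReal_le (cumul ν x)]
  congr 1
  ext s
  exact and_congr_right fun hs => hT.le_iff s hs x

lemma map_powerTail_Ioi (hT : IsQuantile ν T) (hα : 0 < α) (x : ℝ) :
    (powerTail α).map T (Ioi x) = cumul ν x ^ (-α) := by
  rw [Measure.map_apply hT.measurable measurableSet_Ioi, ← powerTail_lt_ofReal hα]
  refine measure_congr (eventuallyEq_set.2 ((ae_powerTail_mem_Ioi α).mono fun s hs => ?_))
  rw [mem_preimage, mem_Ioi, mem_ofPred_eq, ← not_le, hT.le_iff s hs x, not_le]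

lemma lt_of_lt (hT : IsQuantile ν T) {s t : ℝ} (hs : 0 < s) (ht : 0 < t) (h : T s < T t) :
    s < t := by
  by_contra! hle
  exact h.not_ge ((hT.le_iff t ht _).2
    ((ENNReal.ofReal_le_ofReal hle).trans ((hT.le_iff s hs _).1 le_rfl)))

lemma cumul_lt_top_of_lt (hT : IsQuantile ν T) {t y : ℝ} (ht : 0 < t) (h : y < T t) :
    cumul ν y < ∞ :=
  (not_le.1 fun hle => h.not_ge ((hT.le_iff t ht y).2 hle)).trans ENNReal.ofReal_lt_top

end IsQuantile

lemma restrict_Iic_eq_of_forall {μ ν : Measure ℝ} {a : ℝ} (hfin : μ (Iic a) < ∞)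
    (h : ∀ x, μ (Iic x) = ν (Iic x)) : μ.restrict (Iic a) = ν.restrict (Iic a) := by
  have : IsFiniteMeasure (μ.restrict (Iic a)) := ⟨by rwa [Measure.restrict_apply_univ]⟩
  refine Measure.ext_of_Iic _ _ fun x => ?_
  rw [Measure.restrict_apply measurableSet_Iic, Measure.restrict_apply measurableSet_Iic,
    Iic_inter_Iic, h]

lemma restrict_Ioi_eq_of_forall {μ ν : Measure ℝ} {a : ℝ} (hfin : μ (Ioi a) < ∞)
    (h : ∀ x, μ (Ioi x) = ν (Ioi x)) : μ.restrict (Ioi a) = ν.restrict (Ioi a) := by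
  have : IsFiniteMeasure (μ.restrict (Ioi a)) := ⟨by rwa [Measure.restrict_apply_univ]⟩
  have : IsFiniteMeasure (ν.restrict (Ioi a)) := ⟨by rwa [Measure.restrict_apply_univ, ← h]⟩
  refine Measure.ext_of_Iic _ _ fun x => ?_
  rw [← compl_Ioi, measure_compl measurableSet_Ioi (measure_ne_top _ _),
    measure_compl measurableSet_Ioi (measure_ne_top _ _), Measure.restrict_apply_univ,
    Measure.restrict_apply_univ, Measure.restrict_apply measurableSet_Ioi,
    Measure.restrict_apply measurableSet_Ioi, Ioi_inter_Ioi, h, h]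

lemma IsQuantile.restrict_cumul_lt_top_eq (hT : IsQuantile ν T)
    (hright : ∀ x, cumul ν x < ∞ → ∃ y > x, cumul ν y < ∞) :
    ν.restrict {y | cumul ν y < ∞} =
      ((volume.restrict (Ioi 0)).map T).restrict {y | cumul ν y < ∞} := by
  have hunion : {y | cumul ν y < ∞} = ⋃ r : {r : ℚ // cumul ν r < ∞}, Iic (r.1 : ℝ) := by
    ext y
    simp only [mem_ofPred_eq, mem_iUnion, mem_Iic]
    constructor
    · intro hy
      obtain ⟨z, hz, hzfin⟩ := hright y hy
      obtain ⟨r, hyr, hrz⟩ := exists_rat_btwn hz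
      exact ⟨⟨r, (cumul_mono ν hrz.le).trans_lt hzfin⟩, hyr.le⟩
    · rintro ⟨r, hr⟩
      exact (cumul_mono ν hr).trans_lt r.2
  rw [hunion, Measure.restrict_iUnion_congr]
  exact fun r => restrict_Iic_eq_of_forall r.2 fun x => (hT.map_volume_Iic x).symm

lemma measure_Iio_eq_zero_of_cumul (h : ∀ y < x, cumul ν y = 0) : ν (Iio x) = 0 := by
  have hsub : Iio x ⊆ ⋃ r : {r : ℚ // (r : ℝ) < x}, Iic (r.1 : ℝ) := fun y hy => by
    obtain ⟨r, hyr, hrx⟩ := exists_rat_btwn (mem_Iio.1 hy)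
    exact mem_iUnion.2 ⟨⟨r, hrx⟩, hyr.le⟩
  exact measure_mono_null hsub (measure_iUnion_null fun r => h _ r.2)

end Quantile

section Tail

variable {ν ν' μ : Measure ℝ} {α x : ℝ}

lemma exists_gt_cumul_lt_top_of_tail (hα : 0 < α) (hν' : ∀ x, ν' (Ioi x) = cumul ν x ^ (-α))
    (hx : cumul ν x < ∞) : ∃ y > x, cumul ν y < ∞ := by
  by_contra! hall
  obtain ⟨u, hu, hxu, hlim⟩ := exists_seq_strictAnti_tendsto x
  have hnull : ν' (Ioi x) = 0 := by
    rw [← (isGLB_of_tendsto_atTop hu.antitone hlim).iUnion_Ioi_eq]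
    exact measure_iUnion_null fun n => by
      rw [hν', top_le_iff.1 (hall _ (hxu n)), ENNReal.top_rpow_of_neg (by linarith)]
  rw [hν', ENNReal.rpow_eq_zero_iff] at hnull
  rcases hnull with h | h
  · linarith [h.2]
  · exact hx.ne h.1

lemma eq_zero_of_tail (hα : 0 < α) (hν' : ∀ x, ν' (Ioi x) = cumul ν x ^ (-α))
    (htop : ∀ x, cumul ν x = ∞) : ν' = 0 := by
  have hunion : (univ : Set ℝ) = ⋃ n : ℕ, Ioi (-(n : ℝ)) :=
    (eq_univ_of_forall fun x => mem_iUnion.2 ((exists_nat_gt (-x)).imp fun n hn => by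
      rw [mem_Ioi]; linarith)).symm
  rw [← Measure.measure_univ_eq_zero, hunion]
  exact measure_iUnion_null fun n => by rw [hν', htop, ENNReal.top_rpow_of_neg (by linarith)]

lemma restrict_exists_cumul_pos_eq_of_tail (hα : 0 < α)
    (hν' : ∀ x, ν' (Ioi x) = cumul ν x ^ (-α)) (hμ : ∀ x, μ (Ioi x) = cumul ν x ^ (-α)) :
    ν'.restrict {x | ∃ y < x, 0 < cumul ν y} = μ.restrict {x | ∃ y < x, 0 < cumul ν y} := by
  have hunion : {x | ∃ y < x, 0 < cumul ν y} = ⋃ r : {r : ℚ // 0 < cumul ν r}, Ioi (r.1 : ℝ) := by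
    ext x
    simp only [mem_ofPred_eq, mem_iUnion, mem_Ioi]
    constructor
    · rintro ⟨y, hyx, hy⟩
      obtain ⟨r, hyr, hrx⟩ := exists_rat_btwn hyx
      exact ⟨⟨r, hy.trans_le (cumul_mono ν hyr.le)⟩, hrx⟩
    · rintro ⟨r, hr⟩
      exact ⟨r.1, hr, r.2⟩
  rw [hunion, Measure.restrict_iUnion_congr]
  refine fun r => restrict_Ioi_eq_of_forall ?_ fun x => by rw [hν', hμ]
  rw [hν', lt_top_iff_ne_top, Ne, ENNReal.rpow_eq_top_iff]
  rintro (h | h)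
  · exact r.2.ne' h.1
  · linarith [h.2]

end Tail

section Transfer

variable {ν ν' μ : Measure ℝ} {T : ℝ → ℝ} {p q α : ℝ} {f : ℝ → ℝ≥0∞}

lemma measurable_setLIntegral_Iio (ν : Measure ℝ) (f : ℝ → ℝ≥0∞) :
    Measurable fun x => ∫⁻ y in Iio x, f y ∂ν :=
  Monotone.measurable fun _ _ hxy => lintegral_mono_set (Iio_subset_Iio hxy)

lemma lintegral_rpow_setLIntegral_Iio_congr_of_tail (hq : 0 < q) (hα : 0 < α)
    (hν' : ∀ x, ν' (Ioi x) = cumul ν x ^ (-α)) (hμ : ∀ x, μ (Ioi x) = cumul ν x ^ (-α)) :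
    ∫⁻ x, (∫⁻ y in Iio x, f y ∂ν) ^ q ∂ν' = ∫⁻ x, (∫⁻ y in Iio x, f y ∂ν) ^ q ∂μ := by
  have hsupp : Function.support (fun x => (∫⁻ y in Iio x, f y ∂ν) ^ q) ⊆
      {x | ∃ y < x, 0 < cumul ν y} := by
    refine Function.support_subset_iff'.2 fun x hx => ?_
    have hnull : ν (Iio x) = 0 := measure_Iio_eq_zero_of_cumul fun y hy =>
      of_not_not fun hne => hx ⟨y, hy, pos_iff_ne_zero.2 hne⟩
    rw [setLIntegral_measure_zero _ _ hnull, ENNReal.zero_rpow_of_pos hq]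
  rw [← setLIntegral_eq_of_support_subset hsupp, restrict_exists_cumul_pos_eq_of_tail hα hν' hμ,
    setLIntegral_eq_of_support_subset hsupp]

namespace IsQuantile

lemma setLIntegral_Iio_le (hT : IsQuantile ν T)
    (hright : ∀ x, cumul ν x < ∞ → ∃ y > x, cumul ν y < ∞) (hf : Measurable f) {t : ℝ}
    (ht : 0 < t) :
    ∫⁻ y in Iio (T t), f y ∂ν ≤ ∫⁻ s in Ioc 0 t, indicator {y | cumul ν y < ∞} f (T s) := by
  have hsub : Iio (T t) ⊆ {y | cumul ν y < ∞} := fun y hy => hT.cumul_lt_top_of_lt ht hy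
  have hrestrict := Measure.restrict_congr_mono hsub (hT.restrict_cumul_lt_top_eq hright)
  have hpre := hT.measurable (measurableSet_Iio (a := T t))
  calc ∫⁻ y in Iio (T t), f y ∂ν = ∫⁻ s in T ⁻¹' Iio (T t) ∩ Ioi 0, f (T s) := by
        rw [hrestrict, setLIntegral_map measurableSet_Iio hf hT.measurable,
          Measure.restrict_restrict hpre]
    _ = ∫⁻ s in T ⁻¹' Iio (T t) ∩ Ioi 0, indicator {y | cumul ν y < ∞} f (T s) :=
        setLIntegral_congr_fun (hpre.inter measurableSet_Ioi) fun s hs =>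
          (indicator_of_mem (hsub hs.1) f).symm
    _ ≤ ∫⁻ s in Ioc 0 t, indicator {y | cumul ν y < ∞} f (T s) :=
        lintegral_mono_set fun s hs => ⟨hs.2, (hT.lt_of_lt hs.2 ht hs.1).le⟩

lemma lintegral_rpow_indicator_le (hT : IsQuantile ν T)
    (hright : ∀ x, cumul ν x < ∞ → ∃ y > x, cumul ν y < ∞) (hf : Measurable f) (hp : 0 < p) :
    ∫⁻ s in Ioi 0, indicator {y | cumul ν y < ∞} f (T s) ^ p ≤ ∫⁻ y, f y ^ p ∂ν := by
  have hfin := measurableSet_cumul_lt_top ν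
  calc ∫⁻ s in Ioi 0, indicator {y | cumul ν y < ∞} f (T s) ^ p
      = ∫⁻ y, indicator {y | cumul ν y < ∞} f y ^ p ∂(volume.restrict (Ioi 0)).map T :=
        (lintegral_map ((hf.indicator hfin).pow_const p) hT.measurable).symm
    _ = ∫⁻ y, indicator {y | cumul ν y < ∞} (fun y => f y ^ p) y
          ∂(volume.restrict (Ioi 0)).map T :=
        lintegral_congr fun y => congrFun (indicator_comp_of_zero
          (g := (· ^ p)) (ENNReal.zero_rpow_of_pos hp)).symm y
    _ = ∫⁻ y in {y | cumul ν y < ∞}, f y ^ p ∂ν := by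
        rw [lintegral_indicator hfin, hT.restrict_cumul_lt_top_eq hright]
    _ ≤ _ := setLIntegral_le_lintegral _ _

lemma lintegral_rpow_setLIntegral_Iio_le (hT : IsQuantile ν T)
    (hright : ∀ x, cumul ν x < ∞ → ∃ y > x, cumul ν y < ∞) (hf : Measurable f) (hp : 1 < p)
    (hpq : p ≤ q) :
    (∫⁻ x, (∫⁻ y in Iio x, f y ∂ν) ^ q ∂(powerTail (q / p.conjExponent)).map T) ^ (1 / q) ≤
      ENNReal.ofReal (sharpFactor q p) * (∫⁻ y, f y ^ p ∂ν) ^ (1 / p) := by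
  have hp0 : 0 < p := by linarith
  have hq0 : 0 < q := by linarith
  have hg := (hf.indicator (measurableSet_cumul_lt_top ν)).comp hT.measurable
  rw [lintegral_map ((measurable_setLIntegral_Iio ν f).pow_const q) hT.measurable]
  calc (∫⁻ t, (∫⁻ y in Iio (T t), f y ∂ν) ^ q ∂powerTail (q / p.conjExponent)) ^ (1 / q)
      ≤ (∫⁻ t, (∫⁻ s in Ioc 0 t, indicator {y | cumul ν y < ∞} f (T s)) ^ q
          ∂powerTail (q / p.conjExponent)) ^ (1 / q) := by
        refine ENNReal.rpow_le_rpow (lintegral_mono_ae ?_) (by positivity)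
        filter_upwards [ae_powerTail_mem_Ioi (q / p.conjExponent)] with t ht
        exact ENNReal.rpow_le_rpow (hT.setLIntegral_Iio_le hright hf ht) hq0.le
    _ ≤ ENNReal.ofReal (sharpFactor q p) *
          (∫⁻ s in Ioi 0, indicator {y | cumul ν y < ∞} f (T s) ^ p) ^ (1 / p) :=
        lintegral_Ioc_rpow_powerTail_le hp hpq hg
    _ ≤ ENNReal.ofReal (sharpFactor q p) * (∫⁻ y, f y ^ p ∂ν) ^ (1 / p) :=
        mul_le_mul_right (ENNReal.rpow_le_rpow
          (hT.lintegral_rpow_indicator_le hright hf hp0) (by positivity)) _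

end IsQuantile

lemma div_conjExponent_pos (hp : 1 < p) (hpq : p ≤ q) : 0 < q / p.conjExponent :=
  div_pos (by linarith) (Real.HolderConjugate.conjExponent hp).symm.pos

theorem exists_hasBlissTail (hp : 1 < p) (hpq : p ≤ q) (hS : Tendsto (cumul ν) atTop (𝓝 ∞))
    (hfin : ∀ x, cumul ν x < ∞) : ∃ ν', HasBlissTail q p ν ν' := by
  obtain ⟨T, hT⟩ := exists_isQuantile hS ⟨0, hfin 0⟩ fun x _ => ⟨x + 1, by simp, hfin _⟩
  exact ⟨(powerTail (q / p.conjExponent)).map T,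
    hT.map_powerTail_Ioi (div_conjExponent_pos hp hpq)⟩

theorem HasBlissTail.lintegral_rpow_setLIntegral_Iio_le (hν' : HasBlissTail q p ν ν')
    (hp : 1 < p) (hpq : p ≤ q) (hS : Tendsto (cumul ν) atTop (𝓝 ∞)) (hf : Measurable f) :
    (∫⁻ x, (∫⁻ y in Iio x, f y ∂ν) ^ q ∂ν') ^ (1 / q) ≤
      ENNReal.ofReal (sharpFactor q p) * (∫⁻ y, f y ^ p ∂ν) ^ (1 / p) := by
  have hq0 : 0 < q := by linarith
  have hα := div_conjExponent_pos hp hpq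
  by_cases hfin : ∃ x, cumul ν x < ∞
  · have hright (x : ℝ) (hx : cumul ν x < ∞) := exists_gt_cumul_lt_top_of_tail hα hν' hx
    obtain ⟨T, hT⟩ := exists_isQuantile hS hfin hright
    rw [lintegral_rpow_setLIntegral_Iio_congr_of_tail hq0 hα hν' (hT.map_powerTail_Ioi hα)]
    exact hT.lintegral_rpow_setLIntegral_Iio_le hright hf hp hpq
  · push Not at hfin
    rw [eq_zero_of_tail hα hν' fun x => top_le_iff.1 (hfin x), lintegral_zero_measure,
      ENNReal.zero_rpow_of_pos (by positivity)]
    exact zero_le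

end Transfer

theorem lemma2p2 (p q : ℝ) (hp : 1 < p) (hpq : p ≤ q) (ν : Measure ℝ)
    (hS : Tendsto (cumul ν) atTop (𝓝 ∞)) :
    ((∀ x, cumul ν x < ∞) → ∃ ν' : Measure ℝ, HasBlissTail q p ν ν') ∧
    ∀ ν' : Measure ℝ, HasBlissTail q p ν ν' →
      ∀ f : ℝ → ℝ, Measurable f → (∀ y, 0 ≤ f y) →
        (∫⁻ x, (∫⁻ y in Iio x, ENNReal.ofReal (f y) ∂ν) ^ q ∂ν') ^ (1 / q) ≤
          ENNReal.ofReal (sharpFactor q p) *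
            (∫⁻ y, ENNReal.ofReal (f y ^ p) ∂ν) ^ (1 / p) := by
  refine ⟨exists_hasBlissTail hp hpq hS, fun ν' hν' f hf hf0 => ?_⟩
  have hp0 : 0 ≤ p := by linarith
  simp_rw [← ENNReal.ofReal_rpow_of_nonneg (hf0 _) hp0]
  exact hν'.lintegral_rpow_setLIntegral_Iio_le hp hpq hS hf.ennreal_ofReal
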